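/- Let $p_+,p_-\ge 2$ be coprime integers and put $\alpha_+=\sqrt{2p_- /p_+}$, $\alpha_-=-\sqrt{2p_+/p_-}$, $\alpha_0=\alpha_++\alpha_-$, $\alpha=\sqrt{2p_+p_-}$ and $\alpha_{r,s;n}=\frac{1-r}{2}\alpha_++\frac{1-s}{2}\alpha_-+\frac n2\alpha$ for $r,s,n\in\mathbb Z$. For $\epsilon,\lambda\in\mathbb C$ and $\operatorname{Im}\tau>0$, $q=e^{2\pi i\tau}$, the regularised character of the Fock module $\mathcal F_\lambda$ is $$\mathrm{ch}[\mathcal F_\lambda^\epsilon](\tau)=e^{2\pi\epsilon(\lambda-\alpha_0/2)}\,\frac{q^{(\lambda-\alpha_0/2)^2/2}}{\eta(\tau)},$$ and $\mathcal F_{r,s;n}:=\mathcal F_{\alpha_{r,s;n}}$. The (unregularised) minimal model characters are $\mathrm{ch}[\mathcal L_{r,s}]=\sum_{k\in\mathbb Z}\big(\mathrm{ch}[\mathcal F^0_{r,s;2k}]-\mathrm{ch}[\mathcal F^0_{p_+-r,s;2k+1}]\big)$. The regularised characters of the atypical modules $\mathcal I_{r,s;n}$ ($1\le r\le p_+$,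 $1\le s\le p_-$, $n\in\mathbb Z$) of the singlet algebra are as follows. For $r<p_+$ and $s<p_-$, $$\mathrm{ch}[\mathcal I_{r,s;n}^\epsilon]=n\,\delta_{n\ge0}\big(\delta_{n\,\mathrm{even}}\,\mathrm{ch}[\mathcal L_{r,s}]-\delta_{n\,\mathrm{odd}}\,\mathrm{ch}[\mathcal L_{r,p_--s}]\big)$$ $$+\sum_{k\ge0}(k+1)\Big(\mathrm{ch}[\mathcal F^\epsilon_{p_+-r,s;n-2k-1}]+\mathrm{ch}[\mathcal F^\epsilon_{r,p_--s;n-2k-3}]-\mathrm{ch}[\mathcal F^\epsilon_{r,s;n-2k-2}]-\mathrm{ch}[\mathcal F^\epsilon_{p_+-r,p_--s;n-2k-2}]\Big);$$ in the border cases, $$\mathrm{ch}[\mathcal I_{r,p_-;n}^\epsilon]=\sum_{k\ge0}\big(\mathrm{ch}[\mathcal F^\epsilon_{p_+-r,p_-;n-2k-1}]-\mathrm{ch}[\mathcal F^\epsilon_{r,p_-;n-2k-2}]\big)\quad(r<p_+),$$ $$\mathrm{ch}[\mathcal I_{p_+,s;n}^\epsilon]=\sum_{k\ge0}\big(\mathrm{ch}[\mathcal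 F^\epsilon_{p_+,s;n-2k}]-\mathrm{ch}[\mathcal F^\epsilon_{p_+,p_--s;n-2k-1}]\big)\quad(s<p_-),$$ and $\mathrm{ch}[\mathcal I_{p_+,p_-;n}^\epsilon]=\mathrm{ch}[\mathcal F_{p_+,p_-;n}^\epsilon]$. The vacuum module is $\mathcal K_{1,1;0}$, with $\mathrm{ch}[\mathcal K_{1,1;0}^\epsilon]=\mathrm{ch}[\mathcal L_{1,1}]+\mathrm{ch}[\mathcal I_{1,1;0}^\epsilon]$. The regularised quantum dimension is $$\mathrm{qdim}[\mathcal I_{r,s;n}^\epsilon]=\lim_{y\to0^+}\frac{\mathrm{ch}[\mathcal I_{r,s;n}^\epsilon](iy)}{\mathrm{ch}[\mathcal K_{1,1;0}^\epsilon](iy)}.$$ Put $$B_\epsilon^{p_+p_-}=-\min\Big\{\Big|\tfrac{m}{\sqrt{2p_+p_-}}-\operatorname{Im}\epsilon\Big| : m\in\mathbb Z\setminus p_+p_-\mathbb Z\Big\},$$ $$\mathbb S_{k,m}=\Big\{\epsilon\in\mathbb C : k+\tfrac{2m-1}{4p_+p_-}<\tfrac{\operatorname{Im}\epsilon}{\sqrt{2p_+p_-}}<k+\tfrac{2m+1}{4p_+p_-}\Big\}.$$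 Let $k\in\mathbb Z$, $m\in\{0,1,\dots,2p_+p_--1\}$, $\epsilon\in\mathbb S_{k,m}$ with $\operatorname{Re}\epsilon<B_\epsilon^{p_+p_-}$, and, if $m\in\{0,p_+p_-\}$, suppose also that $\epsilon$ is not on the centre line $\frac{\operatorname{Im}\epsilon}{\sqrt{2p_+p_-}}=k+\frac{m}{2p_+p_-}$ of the strip. Then for all $1\le r\le p_+$, $1\le s\le p_-$, $n\in\mathbb Z$ the denominator above is nonzero for all sufficiently small $y>0$, the limit exists, and $\mathrm{qdim}[\mathcal I_{r,s;n}^\epsilon]$ equals * $(-1)^{mn}\,\dfrac{\sin(\pi mr/p_+)\sin(\pi ms/p_-)}{\sin(\pi m/p_+)\sin(\pi m/p_-)}$ if neither $p_+$ nor $p_-$ divides $m$; * $s\,(-1)^{t(p_-n+1+s)}\,\dfrac{\sin(\pi tp_-r/p_+)}{\sin(\pi tp_- /p_+)}$ if $m=tp_-$ and $p_+\nmid m$; * $r\,(-1)^{t(p_+n+1+r)}\,\dfrac{\sin(\pi tp_+s/p_-)}{\sin(\pi tp_+/p_-)}$ if $m=tp_+$ and $p_-\nmid m$; * $(-1)^{n}\,\dfrac{\sin(\pi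 r/p_+)\sin(\pi s/p_-)}{\sin(\pi/p_+)\sin(\pi/p_-)}$ if $m=0$; * $(-1)^{(m+1)n+p_-(r-1)+p_+(s-1)}\,\dfrac{\sin(\pi r/p_+)\sin(\pi s/p_-)}{\sin(\pi/p_+)\sin(\pi/p_-)}$ if $m=p_+p_-$. -/

import Mathlib

open Filter Topology

noncomputable section

namespace Singlet

/-- `α₊ = √(2 p₋ / p₊)`. -/
def alphaPlus (pp pm : ℕ) : ℝ := Real.sqrt (2 * pm / pp)

/-- `α₋ = -√(2 p₊ / p₋)`. -/
def alphaMinus (pp pm : ℕ) : ℝ := -Real.sqrt (2 * pp / pm)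

/-- `α₀ = α₊ + α₋`. -/
def alphaZero (pp pm : ℕ) : ℝ := alphaPlus pp pm + alphaMinus pp pm

/-- `α = p₊ α₊ = -p₋ α₋ = √(2 p₊ p₋)`. -/
def alphaFull (pp pm : ℕ) : ℝ := Real.sqrt (2 * pp * pm)

/-- `α_{r,s;n} = (1-r)/2 α₊ + (1-s)/2 α₋ + n/2 α`. -/
def alphaLabel (pp pm : ℕ) (r s n : ℤ) : ℝ :=
  (1 - r) / 2 * alphaPlus pp pm + (1 - s) / 2 * alphaMinus pp pm + n / 2 * alphaFull pp pm

/-- The character `q^{(lam - α₀/2)² / 2} / η(τ)`, `q = e^{2πiτ}`, of the Fock module of highest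
weight `lam`. -/
def fockChar (pp pm : ℕ) (lam τ : ℂ) : ℂ :=
  Complex.exp (2 * Real.pi * Complex.I * τ * ((lam - (alphaZero pp pm : ℂ) / 2) ^ 2 / 2))
    / ModularForm.eta τ

/-- The regularised Fock character `e^{2πε(lam - α₀/2)} ch[F_lam](τ)`. -/
def fockRegChar (pp pm : ℕ) (ε lam τ : ℂ) : ℂ :=
  Complex.exp (2 * Real.pi * ε * (lam - (alphaZero pp pm : ℂ) / 2)) * fockChar pp pm lam τ

/-- The regularised character of `F_{r,s;n} = F_{α_{r,s;n}}`. -/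
def fockLabelRegChar (pp pm : ℕ) (r s n : ℤ) (ε τ : ℂ) : ℂ :=
  fockRegChar pp pm ε (alphaLabel pp pm r s n : ℂ) τ

/-- The (never regularised) character of the Virasoro minimal model module `L_{r,s}`:
the Euler-Poincaré sum `∑_{k ∈ ℤ} (ch F_{r,s;2k} - ch F_{p₊-r,s;2k+1})`. -/
def virChar (pp pm : ℕ) (r s : ℤ) (τ : ℂ) : ℂ :=
  ∑' k : ℤ, (fockChar pp pm (alphaLabel pp pm r s (2 * k) : ℂ) τ
    - fockChar pp pm (alphaLabel pp pm (pp - r) s (2 * k + 1) : ℂ) τ)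

/-- The regularised character of `I⁺_{r,s;n}`, `1 ≤ r < p₊`, `1 ≤ s ≤ p₋`. -/
def imPlusRegChar (pp pm : ℕ) (r s n : ℤ) (ε τ : ℂ) : ℂ :=
  (if s ≠ pm ∧ 1 ≤ n then
      (if Even n then virChar pp pm r s τ else -virChar pp pm r (pm - s) τ)
    else 0)
  + ∑' k : ℕ, (fockLabelRegChar pp pm (pp - r) s (n - 2 * k - 1) ε τ
      - fockLabelRegChar pp pm r s (n - 2 * k - 2) ε τ)

/-- The regularised character of `I⁻_{r,s;n}`, `1 ≤ r ≤ p₊`, `1 ≤ s < p₋`. -/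
def imMinusRegChar (pp pm : ℕ) (r s n : ℤ) (ε τ : ℂ) : ℂ :=
  (if r ≠ pp ∧ 0 ≤ n then
      (if Even n then -virChar pp pm r s τ else virChar pp pm r (pm - s) τ)
    else 0)
  + ∑' k : ℕ, (fockLabelRegChar pp pm r s (n - 2 * k) ε τ
      - fockLabelRegChar pp pm r (pm - s) (n - 2 * k - 1) ε τ)

/-- The regularised character of `I⁺_{r,s;n} ∩ I⁻_{r,s;n}`, `1 ≤ r < p₊`, `1 ≤ s < p₋`. -/
def imInnerRegChar (pp pm : ℕ) (r s n : ℤ) (ε τ : ℂ) : ℂ :=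
  (if 0 ≤ n then
      (n : ℂ) * (if Even n then virChar pp pm r s τ else -virChar pp pm r (pm - s) τ)
    else 0)
  + ∑' k : ℕ, ((k : ℂ) + 1) *
      (fockLabelRegChar pp pm (pp - r) s (n - 2 * k - 1) ε τ
        + fockLabelRegChar pp pm r (pm - s) (n - 2 * k - 3) ε τ
        - fockLabelRegChar pp pm r s (n - 2 * k - 2) ε τ
        - fockLabelRegChar pp pm (pp - r) (pm - s) (n - 2 * k - 2) ε τ)

/-- The regularised character of `I_{r,s;n}` for `1 ≤ r ≤ p₊`, `1 ≤ s ≤ p₋`, with the border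
conventions `I_{p₊,p₋;n} = F_{p₊,p₋;n}`, `I_{p₊,s;n} = I⁻_{p₊,s;n}`, `I_{r,p₋;n} = I⁺_{r,p₋;n}`. -/
def imRegChar (pp pm : ℕ) (r s n : ℤ) (ε τ : ℂ) : ℂ :=
  if r = pp then
    if s = pm then fockLabelRegChar pp pm r s n ε τ else imMinusRegChar pp pm r s n ε τ
  else
    if s = pm then imPlusRegChar pp pm r s n ε τ else imInnerRegChar pp pm r s n ε τ

/-- The regularised vacuum character `ch[K_{1,1;0}^ε] = ch[L_{1,1}] + ch[I_{1,1;0}^ε]` of the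
singlet algebra. -/
def vacRegChar (pp pm : ℕ) (ε τ : ℂ) : ℂ :=
  virChar pp pm 1 1 τ + imRegChar pp pm 1 1 0 ε τ

/-- The regularised quantum dimension of `I_{r,s;n}` exists and equals `d`: the vacuum character
does not vanish at `iy` for all small `y > 0`, and the ratio of characters tends to `d` as
`y → 0⁺`. -/
def HasQuantumDim (pp pm : ℕ) (r s n : ℤ) (ε d : ℂ) : Prop :=
  (∀ᶠ y : ℝ in 𝓝[>] 0, vacRegChar pp pm ε (Complex.I * y) ≠ 0) ∧
  Tendsto (fun y : ℝ => imRegChar pp pm r s n ε (Complex.I * y)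
      / vacRegChar pp pm ε (Complex.I * y)) (𝓝[>] 0) (𝓝 d)

/-- `B_ε^q = -min { |m / √(2q) - Im ε| : m ∈ ℤ \ qℤ }`. -/
def wall (q : ℕ) (ε : ℂ) : ℝ :=
  -sInf {d : ℝ | ∃ m : ℤ, ¬ (q : ℤ) ∣ m ∧ d = |m / Real.sqrt (2 * q) - ε.im|}

/-- The open horizontal strip `S_{k,m}`. -/
def strip (pp pm : ℕ) (k m : ℤ) : Set ℂ :=
  {ε : ℂ | (k : ℝ) + (2 * m - 1) / (4 * pp * pm) < ε.im / Real.sqrt (2 * pp * pm) ∧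
    ε.im / Real.sqrt (2 * pp * pm) < (k : ℝ) + (2 * m + 1) / (4 * pp * pm)}

end Singlet

end

/-! Put A = `alphaFull`. The momentum of `F_{r,s;n}` is A b with b = (n - r/p₊ + s/p₋)/2, so after
multiplication by η(iy) each character becomes a sum of Gaussians `gauss A ε b y`. η cancels in the
quantum dimension, and only the behaviour of these sums as y → 0⁺ matters.

Since Re ε < 0, the sums over k ≥ 0 run in the direction in which e^{2πεAb} grows. Completing one to
a sum over ℤ adds a geometric tail bounded uniformly in y, and Poisson summation turns the full sum
into dual Gaussians of modulus exp(π((Re ε)² - (Im ε - g/A)²)/y)/(A√y). The linear weights k + 1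
produce an extra factor (ε - ig/A)/y. Minimal model characters carry no ε, so they are only O(1/√y)
and disappear. Hence every character has an expansion with coefficients `coefP` (order y⁰) and
`coefQ` (order y⁻¹), and the border formulas are the specialisations of the same coefficients
(`hasExpansion_imRegChar`).

`coefQ` contains sin(πgr/p₊) sin(πgs/p₋), and both coefficients vanish when p₊p₋ divides g. Among
the other indices the one with g/A closest to Im ε dominates, and the bound by `wall` says precisely
that its exponent is positive (`isLeading_of_gap`, `HasExpansion.tendsto_sub_lead`). The quantum
dimension is then the ratio of leading coefficients: of `coefQ` if neither p₊ nor p₋ divides g, of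
`coefP` if exactly one does. In the strip `S_{k,m}` the closest index is 2p₊p₋k + m. When p₊p₋
divides m that index is silent and a neighbour leads; which neighbour depends on the side of the
centre line, but the ratio does not. -/

noncomputable section

/-! ### Gaussians and Poisson summation -/

namespace Singlet

/-- The Gaussian `e^{2πεx - πyx²}` at `x = A b`. -/
def gauss (A : ℝ) (ε : ℂ) (b y : ℝ) : ℂ :=
  Complex.exp (2 * Real.pi * ε * (A * b) - Real.pi * y * (A * b) ^ 2)

/-- The Poisson dual `e^{π(ε - ig/A)²/y} / (A √y)` of the Gaussian. -/
def dualGauss (A : ℝ) (ε : ℂ) (g : ℤ) (y : ℝ) : ℂ :=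
  Complex.exp (Real.pi * (ε - Complex.I * g / A) ^ 2 / y) / (A * Real.sqrt y : ℝ)

/-- The phase `e^{2πigb}`. -/
def phase (g : ℤ) (b : ℝ) : ℂ := Complex.exp (2 * Real.pi * Complex.I * g * b)

lemma norm_phase (g : ℤ) (b : ℝ) : ‖phase g b‖ = 1 := by
  have : (2 * Real.pi * Complex.I * g * b : ℂ) = ((2 * Real.pi * g * b : ℝ) : ℂ) * Complex.I := by
    push_cast; ring
  rw [phase, this, Complex.norm_exp_ofReal_mul_I]

lemma phase_add (g : ℤ) (b c : ℝ) : phase g (b + c) = phase g b * phase g c := by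
  simp only [phase, ← Complex.exp_add]
  congr 1; push_cast; ring

section Poisson

variable {A y : ℝ}

/-- Expanding (b + l)² leaves the exponent 2πilz + πil²τ with τ = iA²y and z = bτ - iεA. -/
lemma gauss_eq_theta_term (A y : ℝ) (ε : ℂ) (b : ℝ) (l : ℤ) :
    gauss A ε (b + l) y = gauss A ε b y *
      jacobiTheta₂_term l (b * (Complex.I * (A ^ 2 * y)) - Complex.I * ε * A)
        (Complex.I * (A ^ 2 * y)) := by
  rw [gauss, gauss, jacobiTheta₂_term, ← Complex.exp_add]
  congr 1
  push_cast
  linear_combination (-2 * Real.pi * l * b * A ^ 2 * y + 2 * Real.pi * l * ε * A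
    - Real.pi * l ^ 2 * A ^ 2 * y) * Complex.I_sq

/-- This is the other side of the functional equation of `jacobiTheta₂` at the same z and τ. There
(-iτ)^{1/2} = A√y, and completing the square absorbs the Gaussian at b. -/
lemma dualGauss_eq_theta_term (hA : 0 < A) (hy : 0 < y) (ε : ℂ) (b : ℝ) (g : ℤ) :
    phase g b * dualGauss A ε g y = gauss A ε b y *
      (1 / (-Complex.I * (Complex.I * (A ^ 2 * y))) ^ (1 / 2 : ℂ) *
        Complex.exp (-Real.pi * Complex.I *
          (b * (Complex.I * (A ^ 2 * y)) - Complex.I * ε * A) ^ 2 / (Complex.I * (A ^ 2 * y)))) *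
      jacobiTheta₂_term g
        ((b * (Complex.I * (A ^ 2 * y)) - Complex.I * ε * A) / (Complex.I * (A ^ 2 * y)))
        (-1 / (Complex.I * (A ^ 2 * y))) := by
  have hA' : (A : ℂ) ≠ 0 := by exact_mod_cast hA.ne'
  have hy' : (y : ℂ) ≠ 0 := by exact_mod_cast hy.ne'
  have hI := Complex.I_ne_zero
  have hK : (-Complex.I * (Complex.I * (A ^ 2 * y))) ^ (1 / 2 : ℂ) = (A * Real.sqrt y : ℝ) := by
    have h1 : (-Complex.I * (Complex.I * (A ^ 2 * y))) = ((A ^ 2 * y : ℝ) : ℂ) := by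
      push_cast; linear_combination (-(A : ℂ) ^ 2 * y) * Complex.I_sq
    have h2 : (1 / 2 : ℂ) = ((1 / 2 : ℝ) : ℂ) := by push_cast; rfl
    rw [h1, h2, ← Complex.ofReal_cpow (by positivity), ← Real.sqrt_eq_rpow,
      Real.sqrt_mul (by positivity), Real.sqrt_sq hA.le]
  have key (u v w p q K : ℂ) (h : u + v = w + p + q) :
      Complex.exp u * (Complex.exp v / K)
        = Complex.exp w * (1 / K * Complex.exp p) * Complex.exp q := by
    have h2 := congrArg Complex.exp h
    simp only [Complex.exp_add] at h2
    linear_combination h2 / K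
  rw [hK]
  apply key
  field_simp
  linear_combination (((b : ℂ) ^ 2 * A ^ 4 * y ^ 2 - 2 * b * A ^ 3 * y * ε + A ^ 2 * ε ^ 2)
    + g ^ 2) * Complex.I_sq

/-- Poisson summation for the shifted Gaussian. -/
lemma exists_hasSum_gauss (hA : 0 < A) (hy : 0 < y) (ε : ℂ) (b : ℝ) :
    ∃ S, HasSum (fun l : ℤ => gauss A ε (b + l) y) S ∧
      HasSum (fun g : ℤ => phase g b * dualGauss A ε g y) S := by
  set τ : ℂ := Complex.I * (A ^ 2 * y) with hτdef
  set z : ℂ := b * τ - Complex.I * ε * A with hz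
  have hτim : τ.im = A ^ 2 * y := by
    have : τ = Complex.I * ((A ^ 2 * y : ℝ) : ℂ) := by rw [hτdef]; push_cast; rfl
    rw [this, Complex.I_mul_im, Complex.ofReal_re]
  have hτ : 0 < τ.im := by rw [hτim]; positivity
  have hτ' : 0 < (-1 / τ).im := by
    rw [div_eq_mul_inv, neg_one_mul, Complex.neg_im, Complex.inv_im, neg_div, neg_neg]
    exact div_pos hτ (Complex.normSq_pos.mpr fun h => lt_irrefl 0 (Complex.zero_im ▸ h ▸ hτ))
  refine ⟨gauss A ε b y * jacobiTheta₂ z τ, ?_, ?_⟩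
  · simp_rw [gauss_eq_theta_term]
    exact (hasSum_jacobiTheta₂_term z hτ).mul_left _
  · have hd := dualGauss_eq_theta_term hA hy ε b
    rw [← hτdef, ← hz] at hd
    rw [jacobiTheta₂_functional_equation]
    generalize 1 / (-Complex.I * τ) ^ (1 / 2 : ℂ) *
      Complex.exp (-Real.pi * Complex.I * z ^ 2 / τ) = C at hd ⊢
    rw [← mul_assoc]
    simp_rw [hd]
    exact (hasSum_jacobiTheta₂_term (z / τ) hτ').mul_left _

/-- Poisson summation for the shifted Gaussian weighted by its argument. -/
lemma exists_hasSum_mul_gauss (hA : 0 < A) (hy : 0 < y) (ε : ℂ) (b : ℝ) :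
    ∃ S, HasSum (fun l : ℤ => ((b + l : ℝ) : ℂ) * gauss A ε (b + l) y) S ∧
      HasSum (fun g : ℤ => phase g b * ((ε - Complex.I * g / A) / (A * y)) *
        dualGauss A ε g y) S := by
  obtain ⟨S, hS, hS'⟩ := exists_hasSum_gauss hA hy ε b
  set τ : ℂ := Complex.I * (A ^ 2 * y) with hτdef
  set z : ℂ := b * τ - Complex.I * ε * A with hz
  have hA' : (A : ℂ) ≠ 0 := by exact_mod_cast hA.ne'
  have hy' : (y : ℂ) ≠ 0 := by exact_mod_cast hy.ne'
  have hI := Complex.I_ne_zero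
  have hpi : (Real.pi : ℂ) ≠ 0 := by exact_mod_cast Real.pi_ne_zero
  have hτim : τ.im = A ^ 2 * y := by
    have : τ = Complex.I * ((A ^ 2 * y : ℝ) : ℂ) := by rw [hτdef]; push_cast; rfl
    rw [this, Complex.I_mul_im, Complex.ofReal_re]
  have hτ : 0 < τ.im := by rw [hτim]; positivity
  have hτ' : 0 < (-1 / τ).im := by
    rw [div_eq_mul_inv, neg_one_mul, Complex.neg_im, Complex.inv_im, neg_div, neg_neg]
    exact div_pos hτ (Complex.normSq_pos.mpr fun h => lt_irrefl 0 (Complex.zero_im ▸ h ▸ hτ))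
  refine ⟨b * S + gauss A ε b y / (2 * Real.pi * Complex.I) * jacobiTheta₂' z τ, ?_, ?_⟩
  · refine ((hS.mul_left (b : ℂ)).add ((hasSum_jacobiTheta₂'_term z hτ).mul_left
      (gauss A ε b y / (2 * Real.pi * Complex.I)))).congr_fun ?_
    intro l
    rw [jacobiTheta₂'_term, gauss_eq_theta_term, ← hτdef, ← hz]
    push_cast
    field_simp
  · have hd := dualGauss_eq_theta_term hA hy ε b
    rw [← hτdef, ← hz] at hd
    rw [jacobiTheta₂'_functional_equation]
    have h3 := ((hasSum_jacobiTheta₂'_term (z / τ) hτ').sub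
      ((hasSum_jacobiTheta₂_term (z / τ) hτ').mul_left (2 * Real.pi * Complex.I * z))).mul_left
        (gauss A ε b y / (2 * Real.pi * Complex.I) *
          (1 / (-Complex.I * τ) ^ (1 / 2 : ℂ) * Complex.exp (-Real.pi * Complex.I * z ^ 2 / τ) / τ))
    rw [← mul_assoc]
    refine ((hS'.mul_left (b : ℂ)).add h3).congr_fun ?_
    intro g
    -- The functional equation of the derivative weights the dual terms by (g - z)/τ; the shift b
    -- completes this to the stated weight.
    have hq : (ε - Complex.I * g / A) / (A * y) = b + (g - z) / τ := by
      rw [hz, hτdef]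
      field_simp
      linear_combination (-(g : ℂ)) * Complex.I_sq
    have hτ0 : τ ≠ 0 := by rw [hτdef]; positivity
    rw [hq, mul_right_comm, hd, jacobiTheta₂'_term]
    field_simp

end Poisson

/-! ### Expansions in dual Gaussians -/

/-- As `y → 0⁺`, up to an error `O(1 + 1/√y)`, the function `X` is the superposition of the dual
Gaussians with bounded coefficients `P g + Q g (ε - ig/A) / y`. -/
def HasExpansion (A : ℝ) (ε : ℂ) (X : ℝ → ℂ) (P Q : ℤ → ℂ) : Prop :=
  ∃ C : ℝ, (∀ g, ‖P g‖ ≤ C ∧ ‖Q g‖ ≤ C) ∧ ∀ y : ℝ, 0 < y → y ≤ 1 →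
    ∃ S, HasSum (fun g : ℤ =>
      (P g + Q g * ((ε - Complex.I * g / A) / y)) * dualGauss A ε g y) S ∧
      ‖X y - S‖ ≤ C * (1 + 1 / Real.sqrt y)

section Expansion

variable {A : ℝ} {ε : ℂ} {X X₁ X₂ : ℝ → ℂ} {P P₁ P₂ Q Q₁ Q₂ : ℤ → ℂ}

lemma HasExpansion.congr (h : HasExpansion A ε X P Q) (hX : ∀ y, 0 < y → X₁ y = X y)
    (hP : ∀ g, P₁ g = P g) (hQ : ∀ g, Q₁ g = Q g) : HasExpansion A ε X₁ P₁ Q₁ := by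
  obtain rfl : P₁ = P := funext hP
  obtain rfl : Q₁ = Q := funext hQ
  obtain ⟨C, hC, h⟩ := h
  refine ⟨C, hC, fun y hy hy1 => ?_⟩
  rw [hX y hy]
  exact h y hy hy1

lemma HasExpansion.add (h₁ : HasExpansion A ε X₁ P₁ Q₁) (h₂ : HasExpansion A ε X₂ P₂ Q₂) :
    HasExpansion A ε (fun y => X₁ y + X₂ y) (fun g => P₁ g + P₂ g) (fun g => Q₁ g + Q₂ g) := by
  obtain ⟨C₁, hC₁, h₁⟩ := h₁
  obtain ⟨C₂, hC₂, h₂⟩ := h₂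
  refine ⟨C₁ + C₂, fun g => ⟨norm_add_le_of_le (hC₁ g).1 (hC₂ g).1,
    norm_add_le_of_le (hC₁ g).2 (hC₂ g).2⟩, fun y hy hy1 => ?_⟩
  obtain ⟨S₁, hS₁, hr₁⟩ := h₁ y hy hy1
  obtain ⟨S₂, hS₂, hr₂⟩ := h₂ y hy hy1
  refine ⟨S₁ + S₂, (hS₁.add hS₂).congr_fun fun g => by ring, ?_⟩
  rw [add_mul, add_sub_add_comm]
  exact norm_add_le_of_le hr₁ hr₂

lemma HasExpansion.const_mul (h : HasExpansion A ε X P Q) (c : ℂ) :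
    HasExpansion A ε (fun y => c * X y) (fun g => c * P g) (fun g => c * Q g) := by
  obtain ⟨C, hC, h⟩ := h
  refine ⟨‖c‖ * C, fun g => ?_, fun y hy hy1 => ?_⟩
  · rw [norm_mul, norm_mul]
    exact ⟨by gcongr; exact (hC g).1, by gcongr; exact (hC g).2⟩
  · obtain ⟨S, hS, hr⟩ := h y hy hy1
    refine ⟨c * S, (hS.mul_left c).congr_fun fun g => by ring, ?_⟩
    rw [← mul_sub, norm_mul, mul_assoc]
    gcongr

lemma HasExpansion.sub (h₁ : HasExpansion A ε X₁ P₁ Q₁) (h₂ : HasExpansion A ε X₂ P₂ Q₂) :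
    HasExpansion A ε (fun y => X₁ y - X₂ y) (fun g => P₁ g - P₂ g) (fun g => Q₁ g - Q₂ g) :=
  (h₁.add (h₂.const_mul (-1))).congr (fun y _ => by ring) (fun g => by ring) (fun g => by ring)

/-- Zero coefficients record that X is no larger than the error, hence invisible beside a growing
dual Gaussian. -/
lemma hasExpansion_of_norm_le {C : ℝ}
    (h : ∀ y, 0 < y → y ≤ 1 → ‖X y‖ ≤ C * (1 + 1 / Real.sqrt y)) :
    HasExpansion A ε X 0 0 := by
  have hC : 0 ≤ C := by
    have := (norm_nonneg _).trans (h 1 one_pos le_rfl)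
    simp at this
    linarith
  refine ⟨C, fun g => by simpa using hC, fun y hy hy1 => ⟨0, ?_, by simpa using h y hy hy1⟩⟩
  simp

lemma norm_gauss (A : ℝ) (ε : ℂ) (b y : ℝ) :
    ‖gauss A ε b y‖ = Real.exp (2 * Real.pi * ε.re * (A * b) - Real.pi * y * (A * b) ^ 2) := by
  have : (2 * Real.pi * ε * (A * b) - Real.pi * y * (A * b) ^ 2 : ℂ)
      = ((2 * Real.pi * (A * b) : ℝ) : ℂ) * ε - ((Real.pi * y * (A * b) ^ 2 : ℝ) : ℂ) := by
    push_cast; ring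
  rw [gauss, Complex.norm_exp, this, Complex.sub_re, Complex.re_ofReal_mul, Complex.ofReal_re]
  congr 1; ring

lemma norm_dualGauss (hA : 0 < A) (ε : ℂ) (g : ℤ) {y : ℝ} (hy : 0 < y) :
    ‖dualGauss A ε g y‖
      = Real.exp (Real.pi / y * (ε.re ^ 2 - (ε.im - g / A) ^ 2)) / (A * Real.sqrt y) := by
  have : (Real.pi * (ε - Complex.I * g / A) ^ 2 / y : ℂ)
      = ((Real.pi / y : ℝ) : ℂ) * (ε - ((g / A : ℝ) : ℂ) * Complex.I) ^ 2 := by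
    push_cast; ring
  rw [dualGauss, norm_div, Complex.norm_exp, this, Complex.re_ofReal_mul, Complex.norm_real,
    Real.norm_of_nonneg (by positivity)]
  congr 3
  simp only [sq, Complex.mul_re, Complex.sub_re, Complex.sub_im, Complex.ofReal_re,
    Complex.ofReal_im, Complex.I_re, Complex.I_im, Complex.mul_im]
  ring

lemma hasExpansion_gauss (A : ℝ) (ε : ℂ) (b : ℝ) : HasExpansion A ε (gauss A ε b) 0 0 := by
  refine hasExpansion_of_norm_le (C := Real.exp (2 * Real.pi * ε.re * (A * b))) fun y hy _ => ?_
  rw [norm_gauss]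
  refine (Real.exp_le_exp.2 (sub_le_self _ (by positivity))).trans ?_
  exact le_mul_of_one_le_right (Real.exp_pos _).le (le_add_of_nonneg_right (by positivity))

lemma summable_gauss (hA : 0 < A) (ε : ℂ) (b : ℝ) {y : ℝ} (hy : 0 < y) :
    Summable fun l : ℤ => gauss A ε (b + l) y :=
  (exists_hasSum_gauss hA hy ε b).imp fun _ h => h.1

/-- At ε = 0 the dual exponents -πg²/(A²y) are nonpositive and increase with y, so for y ≤ 1 each
dual term is at most 1/√y times its value at y = 1. -/
lemma hasExpansion_theta_zero (hA : 0 < A) (ε : ℂ) (b : ℝ) :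
    HasExpansion A ε (fun y => ∑' l : ℤ, gauss A 0 (b + l) y) 0 0 := by
  have hsum : Summable fun g : ℤ => ‖phase g b * dualGauss A 0 g 1‖ := by
    obtain ⟨S, -, h⟩ := exists_hasSum_gauss hA one_pos 0 b
    exact h.summable.norm
  refine hasExpansion_of_norm_le (C := ∑' g : ℤ, ‖phase g b * dualGauss A 0 g 1‖)
    fun y hy hy1 => ?_
  obtain ⟨S, h1, h2⟩ := exists_hasSum_gauss hA hy 0 b
  have hle (g : ℤ) : ‖phase g b * dualGauss A 0 g y‖
      ≤ ‖phase g b * dualGauss A 0 g 1‖ * (1 / Real.sqrt y) := by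
    rw [norm_mul, norm_mul, norm_phase, norm_dualGauss hA _ _ hy, norm_dualGauss hA _ _ one_pos]
    simp only [Complex.zero_re, Complex.zero_im, one_mul, Real.sqrt_one, mul_one, div_one]
    rw [div_mul_div_comm, mul_one]
    refine div_le_div_of_nonneg_right (Real.exp_le_exp.2
      (mul_le_mul_of_nonpos_right ?_ (by nlinarith [sq_nonneg (0 - (g : ℝ) / A)]))) (by positivity)
    rw [le_div_iff₀ hy]; nlinarith [Real.pi_pos]
  have h3 := h2.tsum_eq ▸ tsum_of_norm_bounded (hsum.hasSum.mul_right (1 / Real.sqrt y)) hle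
  rw [h1.tsum_eq]
  refine h3.trans ?_
  have : 0 ≤ ∑' g : ℤ, ‖phase g b * dualGauss A 0 g 1‖ := tsum_nonneg fun _ => norm_nonneg _
  nlinarith

/-- A half sum differs from the full sum by the other half, which T controls. -/
lemma exists_hasSum_nat_of_hasSum_int {f : ℤ → ℂ} {S : ℂ} {T : ℕ → ℝ} (hf : HasSum f S)
    (hT : Summable T) (hle : ∀ k : ℕ, ‖f (-(k + 1))‖ ≤ T k) :
    ∃ s, HasSum (fun k : ℕ => f k) s ∧ ‖s - S‖ ≤ ∑' k, T k := by
  have h1 : Summable fun k : ℕ => f k := hf.summable.comp_injective Nat.cast_injective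
  have h2 : Summable fun k : ℕ => f (-(k + 1)) := hT.of_norm_bounded hle
  refine ⟨_, h1.hasSum, ?_⟩
  have h3 := (HasSum.of_nat_of_neg_add_one h1.hasSum h2.hasSum).unique hf
  rw [← h3, sub_add_cancel_left, norm_neg]
  exact tsum_of_norm_bounded hT.hasSum hle

/-- Dropping the quadratic term of the exponent gives a geometric bound independent of y. -/
lemma norm_gauss_tail_le (A : ℝ) (ε : ℂ) (b : ℝ) {y : ℝ} (hy : 0 < y) (k : ℕ) :
    ‖gauss A ε (b + 1 + k) y‖ ≤
      Real.exp (2 * Real.pi * ε.re * A * (b + 1)) * Real.exp (2 * Real.pi * ε.re * A) ^ k := by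
  rw [norm_gauss, ← Real.exp_nat_mul, ← Real.exp_add, Real.exp_le_exp]
  have : 0 ≤ Real.pi * y * (A * (b + 1 + k)) ^ 2 := by positivity
  linarith

/-- Half of the theta series, over the side where the summands grow. -/
lemma hasExpansion_partialTheta (hA : 0 < A) (hε : ε.re < 0) (b : ℝ) :
    HasExpansion A ε (fun y => ∑' k : ℕ, gauss A ε (b - k) y) (fun g => phase g b) 0 := by
  set T : ℕ → ℝ := fun k =>
    Real.exp (2 * Real.pi * ε.re * A * (b + 1)) * Real.exp (2 * Real.pi * ε.re * A) ^ k with hTdef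
  have hr : Real.exp (2 * Real.pi * ε.re * A) < 1 := by
    rw [Real.exp_lt_one_iff]
    have := mul_pos Real.pi_pos hA
    nlinarith
  have hT : Summable T := (summable_geometric_of_lt_one (Real.exp_pos _).le hr).mul_left _
  have hT0 : 0 ≤ ∑' k, T k := tsum_nonneg fun k => by positivity
  refine ⟨1 + ∑' k, T k, fun g => ⟨by rw [norm_phase]; linarith, by simp; linarith⟩,
    fun y hy hy1 => ?_⟩
  obtain ⟨S, h1, h2⟩ := exists_hasSum_gauss hA hy ε b
  have h1' : HasSum (fun l : ℤ => gauss A ε (b - l) y) S := by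
    have := (Equiv.neg ℤ).hasSum_iff.2 h1
    refine this.congr_fun fun l => ?_
    simp [sub_eq_add_neg]
  obtain ⟨s, hs, hle⟩ := exists_hasSum_nat_of_hasSum_int h1' hT fun k => by
    have := norm_gauss_tail_le A ε b hy k
    convert this using 3
    push_cast; ring
  refine ⟨S, by simpa using h2, ?_⟩
  have h3 : HasSum (fun k : ℕ => gauss A ε (b - k) y) s := by simpa using hs
  beta_reduce
  rw [h3.tsum_eq]
  refine hle.trans ?_
  have : 0 ≤ 1 / Real.sqrt y := by positivity
  nlinarith

lemma summable_gauss_left (hA : 0 < A) (ε : ℂ) (b : ℝ) {y : ℝ} (hy : 0 < y) :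
    Summable fun k : ℕ => gauss A ε (b - k) y := by
  have h := (summable_gauss hA ε b hy).comp_injective (i := fun k : ℕ => -(k : ℤ))
    (neg_injective.comp Nat.cast_injective)
  refine h.congr fun k => ?_
  simp [sub_eq_add_neg]

lemma summable_mul_gauss_left (hA : 0 < A) (ε : ℂ) (b : ℝ) {y : ℝ} (hy : 0 < y) :
    Summable fun k : ℕ => ((k : ℂ) + 1) * gauss A ε (b - k) y := by
  obtain ⟨S, h1, -⟩ := exists_hasSum_mul_gauss hA hy ε b
  have h := h1.summable.comp_injective (i := fun k : ℕ => -(k : ℤ))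
    (neg_injective.comp Nat.cast_injective)
  -- The weight is split as k + 1 = (b + 1) - (b - k): a constant minus the argument.
  refine (((summable_gauss_left hA ε b hy).mul_left ((b : ℂ) + 1)).sub h).congr fun k => ?_
  simp only [Function.comp, Int.cast_neg, Int.cast_natCast, ← sub_eq_add_neg]
  push_cast; ring

/-- Half of the theta series with linear weights, over the side where the summands grow. -/
lemma hasExpansion_weighted_partialTheta (hA : 0 < A) (hε : ε.re < 0) (b : ℝ) :
    HasExpansion A ε (fun y => ∑' k : ℕ, ((k : ℂ) + 1) * gauss A ε (b - k) y)
      (fun g => (b + 1) * phase g b) (fun g => -phase g b / A) := by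
  have hA' : (A : ℂ) ≠ 0 := by exact_mod_cast hA.ne'
  -- Extended to l = -(k + 1), the weight l + 1 equals -k, whence the factor k in the tail bound.
  set T : ℕ → ℝ := fun k =>
    Real.exp (2 * Real.pi * ε.re * A * (b + 1)) *
      ((k : ℝ) ^ 1 * Real.exp (2 * Real.pi * ε.re * A) ^ k) with hTdef
  have hr : Real.exp (2 * Real.pi * ε.re * A) < 1 := by
    rw [Real.exp_lt_one_iff]
    have := mul_pos Real.pi_pos hA
    nlinarith
  have hT : Summable T := by
    have hr' : ‖Real.exp (2 * Real.pi * ε.re * A)‖ < 1 := by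
      rwa [Real.norm_of_nonneg (Real.exp_pos _).le]
    exact (summable_pow_mul_geometric_of_norm_lt_one 1 hr').mul_left _
  have hT0 : 0 ≤ ∑' k, T k := tsum_nonneg fun k => by positivity
  have hA1 : 0 < 1 / A := by positivity
  refine ⟨|b + 1| + 1 / A + ∑' k, T k, fun g => ⟨?_, ?_⟩, fun y hy hy1 => ?_⟩
  · have : ((b : ℂ) + 1) = ((b + 1 : ℝ) : ℂ) := by push_cast; rfl
    rw [norm_mul, norm_phase, this, Complex.norm_real, Real.norm_eq_abs]
    linarith
  · rw [norm_div, norm_neg, norm_phase, Complex.norm_real, Real.norm_of_nonneg hA.le]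
    linarith [abs_nonneg (b + 1)]
  obtain ⟨S, h1, h2⟩ := exists_hasSum_gauss hA hy ε b
  obtain ⟨S', h1', h2'⟩ := exists_hasSum_mul_gauss hA hy ε b
  have h3 : HasSum (fun l : ℤ => ((l : ℂ) + 1) * gauss A ε (b - l) y) ((b + 1) * S - S') := by
    have := (Equiv.neg ℤ).hasSum_iff.2 ((h1.mul_left ((b : ℂ) + 1)).sub h1')
    refine this.congr_fun fun l => ?_
    simp only [Function.comp, Equiv.neg_apply, Int.cast_neg, ← sub_eq_add_neg]
    push_cast; ring
  obtain ⟨s, hs, hle⟩ := exists_hasSum_nat_of_hasSum_int h3 hT fun k => by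
    have := norm_gauss_tail_le A ε b hy k
    have h4 : (((-((k : ℤ) + 1) : ℤ) : ℂ) + 1) = -(k : ℂ) := by push_cast; ring
    have h5 : b - ((-((k : ℤ) + 1) : ℤ) : ℝ) = b + 1 + k := by push_cast; ring
    rw [h4, h5, norm_mul, norm_neg, Complex.norm_natCast, hTdef]
    refine (mul_le_mul_of_nonneg_left this (Nat.cast_nonneg k)).trans (le_of_eq ?_)
    ring
  refine ⟨(b + 1) * S - S', ?_, ?_⟩
  · refine ((h2.mul_left ((b : ℂ) + 1)).sub h2').congr_fun fun g => ?_
    field_simp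
    ring
  · have h4 : HasSum (fun k : ℕ => ((k : ℂ) + 1) * gauss A ε (b - k) y) s := by simpa using hs
    beta_reduce
    rw [h4.tsum_eq]
    refine hle.trans ?_
    have : 0 ≤ 1 / Real.sqrt y := by positivity
    nlinarith [abs_nonneg (b + 1)]

end Expansion

/-! ### Isolating the dominant dual Gaussian -/

lemma tendsto_inv_mul_exp_neg_div {κ : ℝ} (hκ : 0 < κ) :
    Tendsto (fun y : ℝ => 1 / y * Real.exp (-(κ / y))) (𝓝[>] 0) (𝓝 0) := by
  have h1 : Tendsto (fun y : ℝ => κ * y⁻¹) (𝓝[>] 0) atTop :=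
    tendsto_inv_nhdsGT_zero.const_mul_atTop hκ
  have h2 := ((Real.tendsto_pow_mul_exp_neg_atTop_nhds_zero 1).comp h1).const_mul (1 / κ)
  rw [mul_zero] at h2
  refine h2.congr fun y => ?_
  simp only [Function.comp, pow_one, ← div_eq_mul_inv]
  field_simp

lemma summable_abs_pow_mul_exp_neg (k : ℕ) {c : ℝ} (hc : 0 < c) :
    Summable fun d : ℤ => |(d : ℝ)| ^ k * Real.exp (-c * |(d : ℝ)|) := by
  have h := Real.summable_pow_mul_exp_neg_nat_mul k hc
  refine Summable.of_nat_of_neg ?_ ?_ <;> simpa using h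

lemma summable_norm_mul_exp_neg (A : ℝ) (ε : ℂ) (g₀ : ℤ) {c : ℝ} (hc : 0 < c) :
    Summable fun g : ℤ =>
      (1 + ‖ε - Complex.I * g / A‖) * Real.exp (-c * |((g - g₀ : ℤ) : ℝ)|) := by
  have h0 := (summable_abs_pow_mul_exp_neg 0 hc).mul_left (1 + ‖ε - Complex.I * g₀ / A‖)
  have h1 := (summable_abs_pow_mul_exp_neg 1 hc).mul_left ‖(1 / A : ℂ)‖
  have h2 := (Equiv.subRight g₀).summable_iff.2 (h0.add h1)
  refine h2.of_nonneg_of_le (fun g => by positivity) fun g => ?_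
  simp only [Function.comp, Equiv.subRight_apply, pow_zero, pow_one, one_mul]
  rw [← mul_assoc, ← add_mul]
  refine mul_le_mul_of_nonneg_right ?_ (Real.exp_pos _).le
  have h3 : ε - Complex.I * g / A
      = (ε - Complex.I * g₀ / A) - Complex.I * ((1 / A : ℂ) * ((g - g₀ : ℤ) : ℂ)) := by
    push_cast; ring
  have h4 : ‖Complex.I * ((1 / A : ℂ) * ((g - g₀ : ℤ) : ℂ))‖
      = ‖(1 / A : ℂ)‖ * |((g - g₀ : ℤ) : ℝ)| := by
    rw [norm_mul, Complex.norm_I, one_mul, norm_mul, Complex.norm_intCast]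
  rw [h3, add_assoc, ← h4]
  gcongr
  exact norm_sub_le _ _

lemma dualGauss_ne_zero {A y : ℝ} (hA : 0 < A) (hy : 0 < y) (ε : ℂ) (g : ℤ) :
    dualGauss A ε g y ≠ 0 := by
  have : A * Real.sqrt y ≠ 0 := by positivity
  exact div_ne_zero (Complex.exp_ne_zero _) (by exact_mod_cast this)

lemma norm_dualGauss_div {A y : ℝ} (hA : 0 < A) (hy : 0 < y) (ε : ℂ) (g g₀ : ℤ) :
    ‖dualGauss A ε g y / dualGauss A ε g₀ y‖
      = Real.exp (-(Real.pi / y * ((ε.im - g / A) ^ 2 - (ε.im - g₀ / A) ^ 2))) := by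
  have : A * Real.sqrt y ≠ 0 := by positivity
  rw [norm_div, norm_dualGauss hA _ _ hy, norm_dualGauss hA _ _ hy, div_div_div_cancel_right₀ this,
    ← Real.exp_sub]
  congr 1; ring

/-- The asymptotics of an expansion in which the dual Gaussian of index `g₀` dominates. -/
lemma HasExpansion.tendsto_sub_lead {A : ℝ} {ε : ℂ} {X : ℝ → ℂ} {P Q : ℤ → ℂ} (hA : 0 < A)
    (h : HasExpansion A ε X P Q) {g₀ : ℤ} {δ : ℝ} (hδ : 0 < δ)
    (hgap : ∀ g, g ≠ g₀ → (P g = 0 ∧ Q g = 0) ∨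
      δ * |((g - g₀ : ℤ) : ℝ)| ≤ (ε.im - g / A) ^ 2 - (ε.im - g₀ / A) ^ 2)
    (hdom : (ε.im - g₀ / A) ^ 2 < ε.re ^ 2) :
    Tendsto (fun y => X y / dualGauss A ε g₀ y
      - (P g₀ + Q g₀ * ((ε - Complex.I * g₀ / A) / y))) (𝓝[>] 0) (𝓝 0) := by
  obtain ⟨C, hC, h⟩ := h
  have hC0 : 0 ≤ C := (norm_nonneg _).trans (hC 0).1
  -- κ is the growth rate of the leading dual Gaussian. The gap rate πδ is split in half below: one
  -- half makes the sum over g converge, the other makes it decay as y → 0⁺.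
  set κ := Real.pi * (ε.re ^ 2 - (ε.im - g₀ / A) ^ 2) with hκdef
  have hκ : 0 < κ := mul_pos Real.pi_pos (sub_pos.2 hdom)
  set c := Real.pi * δ / 2 with hcdef
  have hc : 0 < c := by have := Real.pi_pos; positivity
  set B : ℤ → ℝ := fun g => C * ((1 + ‖ε - Complex.I * g / A‖) *
    Real.exp (-c * |((g - g₀ : ℤ) : ℝ)|)) with hB
  have hBs : Summable B := (summable_norm_mul_exp_neg A ε g₀ hc).mul_left C
  have hlim : Tendsto (fun y : ℝ => C * 2 * A * (1 / y * Real.exp (-(κ / y)))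
      + (∑' g, B g) * (1 / y * Real.exp (-(c / y)))) (𝓝[>] 0) (𝓝 0) := by
    simpa using ((tendsto_inv_mul_exp_neg_div hκ).const_mul (C * 2 * A)).add
      ((tendsto_inv_mul_exp_neg_div hc).const_mul (∑' g, B g))
  refine squeeze_zero_norm' ?_ hlim
  have hmem : Set.Ioc (0 : ℝ) 1 ∈ 𝓝[>] (0 : ℝ) := Ioc_mem_nhdsGT one_pos
  filter_upwards [hmem] with y hy
  obtain ⟨hy, hy1⟩ := hy
  obtain ⟨S, hS, hr⟩ := h y hy hy1
  have hE := dualGauss_ne_zero hA hy ε g₀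
  have hy1' : 1 ≤ 1 / y := by rwa [le_div_iff₀ hy, one_mul]
  have hsq : Real.sqrt y ≤ 1 := Real.sqrt_le_one.2 hy1
  have hsq0 : 0 < Real.sqrt y := Real.sqrt_pos.2 hy
  set L := P g₀ + Q g₀ * ((ε - Complex.I * g₀ / A) / y) with hL
  have hmain : ‖S / dualGauss A ε g₀ y - L‖ ≤ (∑' g, B g) * (1 / y * Real.exp (-(c / y))) := by
    have h1 := (hS.div_const (dualGauss A ε g₀ y)).sub (hasSum_ite_eq g₀ L)
    refine h1.tsum_eq ▸ tsum_of_norm_bounded (hBs.hasSum.mul_right _) fun g => ?_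
    have hBg : 0 ≤ B g := by positivity
    have hE0 : 0 ≤ 1 / y * Real.exp (-(c / y)) := by positivity
    by_cases hg : g = g₀
    · subst hg
      rw [if_pos rfl, mul_div_assoc, div_self hE, mul_one, ← hL, sub_self, norm_zero]
      positivity
    rw [if_neg hg, sub_zero]
    rcases hgap g hg with ⟨hP, hQ⟩ | hgap
    · rw [hP, hQ, zero_mul, add_zero, zero_mul, zero_div, norm_zero]
      positivity
    rw [mul_div_assoc, norm_mul, norm_dualGauss_div hA hy]
    have hd : (1 : ℝ) ≤ |((g - g₀ : ℤ) : ℝ)| := by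
      rw [← Int.cast_abs]
      exact_mod_cast Int.one_le_abs (sub_ne_zero.2 hg)
    have hcoef : ‖P g + Q g * ((ε - Complex.I * g / A) / y)‖
        ≤ C * (1 + ‖ε - Complex.I * g / A‖) * (1 / y) := by
      have hyn : ‖(y : ℂ)‖ = y := by rw [Complex.norm_real, Real.norm_of_nonneg hy.le]
      calc _ ≤ ‖P g‖ + ‖Q g‖ * (‖ε - Complex.I * g / A‖ / y) := by
            refine (norm_add_le _ _).trans (le_of_eq ?_)
            rw [norm_mul, norm_div, hyn]
        _ ≤ C * (1 / y) + C * (‖ε - Complex.I * g / A‖ / y) := by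
            gcongr
            · exact (hC g).1.trans (le_mul_of_one_le_right hC0 hy1')
            · exact (hC g).2
        _ = _ := by ring
    have hexp : Real.exp (-(Real.pi / y * ((ε.im - g / A) ^ 2 - (ε.im - g₀ / A) ^ 2)))
        ≤ Real.exp (-c * |((g - g₀ : ℤ) : ℝ)|) * Real.exp (-(c / y)) := by
      rw [← Real.exp_add, Real.exp_le_exp]
      have h2 : Real.pi / y * (δ * |((g - g₀ : ℤ) : ℝ)|)
          ≤ Real.pi / y * ((ε.im - g / A) ^ 2 - (ε.im - g₀ / A) ^ 2) := by
        have := Real.pi_pos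
        gcongr
      have h3 : Real.pi / y * (δ * |((g - g₀ : ℤ) : ℝ)|)
          = c * |((g - g₀ : ℤ) : ℝ)| * (1 / y) + c * (1 / y) * |((g - g₀ : ℤ) : ℝ)| := by
        rw [hcdef]; ring
      have h4 : c * |((g - g₀ : ℤ) : ℝ)| ≤ c * |((g - g₀ : ℤ) : ℝ)| * (1 / y) :=
        le_mul_of_one_le_right (by positivity) hy1'
      have h5 : c * (1 / y) ≤ c * (1 / y) * |((g - g₀ : ℤ) : ℝ)| :=
        le_mul_of_one_le_right (by positivity) hd
      rw [mul_one_div] at h5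
      rw [mul_one_div c y] at h3
      linarith
    calc _ ≤ C * (1 + ‖ε - Complex.I * g / A‖) * (1 / y) *
          (Real.exp (-c * |((g - g₀ : ℤ) : ℝ)|) * Real.exp (-(c / y))) := by gcongr
      _ = _ := by rw [hB]; ring
  -- The error O(1 + 1/√y) is divided by a modulus e^{κ/y}/(A√y). The factor 1/y is inserted only to
  -- match the form of the other bound.
  have hrem : ‖(X y - S) / dualGauss A ε g₀ y‖ ≤ C * 2 * A * (1 / y * Real.exp (-(κ / y))) := by
    have hexp : Real.exp (Real.pi / y * (ε.re ^ 2 - (ε.im - g₀ / A) ^ 2)) = Real.exp (κ / y) := by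
      rw [hκdef]; congr 1; ring
    rw [norm_div, norm_dualGauss hA _ _ hy, hexp, div_div_eq_mul_div, div_eq_mul_inv,
      ← Real.exp_neg]
    calc _ ≤ C * (1 + 1 / Real.sqrt y) * (A * Real.sqrt y) * Real.exp (-(κ / y)) := by gcongr
      _ = C * (Real.sqrt y + 1) * A * Real.exp (-(κ / y)) := by field_simp
      _ ≤ C * 2 * A * Real.exp (-(κ / y)) := by gcongr; linarith
      _ ≤ C * 2 * A * (1 / y * Real.exp (-(κ / y))) := by
          gcongr
          exact le_mul_of_one_le_left (Real.exp_pos _).le hy1'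
  have : X y / dualGauss A ε g₀ y - L
      = (X y - S) / dualGauss A ε g₀ y + (S / dualGauss A ε g₀ y - L) := by ring
  rw [this]
  exact norm_add_le_of_le hrem hmain

/-- Quotients of functions with known leading behaviour. -/
lemma tendsto_div_of_tendsto_mul {X V w : ℝ → ℂ} {a b : ℂ} (hb : b ≠ 0)
    (hX : Tendsto (fun y => X y * w y) (𝓝[>] 0) (𝓝 a))
    (hV : Tendsto (fun y => V y * w y) (𝓝[>] 0) (𝓝 b)) :
    (∀ᶠ y in 𝓝[>] (0 : ℝ), V y ≠ 0) ∧
      Tendsto (fun y => X y / V y) (𝓝[>] 0) (𝓝 (a / b)) := by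
  have h0 := hV.eventually_ne hb
  refine ⟨h0.mono fun y hy h => hy (by rw [h, zero_mul]), (hX.div hV hb).congr' ?_⟩
  filter_upwards [h0] with y hy
  exact mul_div_mul_right _ _ (right_ne_zero_of_mul hy)

/-- Rescaling by y suppresses the order y⁰ coefficient p. -/
lemma tendsto_mul_of_lead {p q z : ℂ} {X E : ℝ → ℂ}
    (h : Tendsto (fun y : ℝ => X y / E y - (p + q * (z / y))) (𝓝[>] 0) (𝓝 0)) :
    Tendsto (fun y : ℝ => X y * (y / E y)) (𝓝[>] 0) (𝓝 (q * z)) := by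
  have hy : Tendsto (fun y : ℝ => (y : ℂ)) (𝓝[>] 0) (𝓝 0) :=
    (Complex.continuous_ofReal.tendsto' 0 0 Complex.ofReal_zero).mono_left nhdsWithin_le_nhds
  have h2 := ((h.mul hy).add (hy.mul_const p)).add_const (q * z)
  simp only [zero_mul, zero_add] at h2
  refine h2.congr' ?_
  filter_upwards [self_mem_nhdsWithin] with y hy
  have : (y : ℂ) ≠ 0 := by exact_mod_cast (Set.mem_Ioi.1 hy).ne'
  field_simp
  ring

lemma phase_half (g : ℤ) (x : ℝ) :
    phase g (x / 2) = Real.cos (Real.pi * g * x) + Real.sin (Real.pi * g * x) * Complex.I := by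
  rw [phase, Complex.ofReal_cos, Complex.ofReal_sin, ← Complex.exp_mul_I]
  congr 1; push_cast; ring

lemma phase_half_intCast (g n : ℤ) : phase g ((n : ℝ) / 2) = (-1) ^ (g * n) := by
  have : (2 * Real.pi * Complex.I * g * ((n : ℝ) / 2 : ℝ) : ℂ)
      = ((g * n : ℤ) : ℂ) * (Real.pi * Complex.I) := by push_cast; ring
  rw [phase, this, Complex.exp_int_mul, Complex.exp_pi_mul_I]

lemma phase_neg_one (g : ℤ) : phase g (-1) = 1 := by
  have := phase_half_intCast g (-2)
  rw [show ((-2 : ℤ) : ℝ) / 2 = -1 by norm_num] at this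
  rw [this]
  exact Even.neg_one_zpow ⟨-g, by ring⟩

/-! ### Expansions of the characters -/

section Characters

variable {pp pm : ℕ}

lemma alphaFull_pos (hpp : 0 < pp) (hpm : 0 < pm) : 0 < alphaFull pp pm :=
  Real.sqrt_pos.2 (by positivity)

lemma alphaFull_sq (pp pm : ℕ) : alphaFull pp pm ^ 2 = 2 * pp * pm :=
  Real.sq_sqrt (by positivity)

lemma alphaPlus_eq (hpp : 0 < pp) : alphaPlus pp pm = alphaFull pp pm / pp := by
  have h : (2 * pm / pp : ℝ) = 2 * pp * pm / pp ^ 2 := by field_simp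
  rw [alphaPlus, h, Real.sqrt_div (by positivity), Real.sqrt_sq (by positivity), alphaFull]

lemma alphaMinus_eq (hpm : 0 < pm) : alphaMinus pp pm = -(alphaFull pp pm / pm) := by
  have h : (2 * pp / pm : ℝ) = 2 * pp * pm / pm ^ 2 := by field_simp
  rw [alphaMinus, h, Real.sqrt_div (by positivity), Real.sqrt_sq (by positivity), alphaFull]

lemma alphaLabel_sub (hpp : 0 < pp) (hpm : 0 < pm) (r s n : ℤ) :
    alphaLabel pp pm r s n - alphaZero pp pm / 2
      = alphaFull pp pm * ((n - r / pp + s / pm) / 2) := by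
  rw [alphaLabel, alphaZero, alphaPlus_eq hpp, alphaMinus_eq hpm]
  ring

lemma fockLabelRegChar_eq (hpp : 0 < pp) (hpm : 0 < pm) (r s n : ℤ) (ε : ℂ) (y : ℝ) {b : ℝ}
    (hb : (n - r / pp + s / pm : ℝ) / 2 = b) :
    fockLabelRegChar pp pm r s n ε (Complex.I * y)
      = gauss (alphaFull pp pm) ε b y / ModularForm.eta (Complex.I * y) := by
  have h : (alphaLabel pp pm r s n : ℂ) - (alphaZero pp pm : ℂ) / 2 = alphaFull pp pm * b := by
    rw [← hb]
    exact_mod_cast alphaLabel_sub hpp hpm r s n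
  rw [fockLabelRegChar, fockRegChar, fockChar, h, ← mul_div_assoc, ← Complex.exp_add, gauss]
  congr 2
  linear_combination (Real.pi * y * (alphaFull pp pm * b) ^ 2 : ℂ) * Complex.I_sq

lemma fockChar_eq (hpp : 0 < pp) (hpm : 0 < pm) (r s n : ℤ) (y : ℝ) {b : ℝ}
    (hb : (n - r / pp + s / pm : ℝ) / 2 = b) :
    fockChar pp pm (alphaLabel pp pm r s n : ℂ) (Complex.I * y)
      = gauss (alphaFull pp pm) 0 b y / ModularForm.eta (Complex.I * y) := by
  rw [← fockLabelRegChar_eq hpp hpm r s n 0 y hb, fockLabelRegChar, fockRegChar]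
  simp

lemma eta_I_mul_ne_zero {y : ℝ} (hy : 0 < y) : ModularForm.eta (Complex.I * y) ≠ 0 := by
  refine ModularForm.eta_ne_zero ?_
  change 0 < (Complex.I * (y : ℂ)).im
  rwa [Complex.I_mul_im, Complex.ofReal_re]

/-- The Euler-Poincaré sum is a difference of two full theta series at ε = 0, so it stays within the
error whatever ε is. -/
lemma hasExpansion_virChar (hpp : 0 < pp) (hpm : 0 < pm) (r s : ℤ) (ε : ℂ) :
    HasExpansion (alphaFull pp pm) ε (fun y =>
      virChar pp pm r s (Complex.I * y) * ModularForm.eta (Complex.I * y)) 0 0 := by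
  have hA := alphaFull_pos hpp hpm
  refine ((hasExpansion_theta_zero hA ε ((-(r / pp) + s / pm) / 2)).sub
    (hasExpansion_theta_zero hA ε ((r / pp + s / pm) / 2))).congr (fun y hy => ?_)
    (fun g => by simp) (fun g => by simp)
  have hη := eta_I_mul_ne_zero hy
  rw [← (summable_gauss hA 0 _ hy).tsum_sub (summable_gauss hA 0 _ hy), virChar, ← tsum_mul_right]
  refine tsum_congr fun l => ?_
  rw [fockChar_eq hpp hpm r s (2 * l) y (b := (-(r / pp) + s / pm) / 2 + l) (by push_cast; ring),
    fockChar_eq hpp hpm (pp - r) s (2 * l + 1) y (b := (r / pp + s / pm) / 2 + l)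
      (by push_cast; field_simp; ring)]
  field_simp

/-- The coefficient of order `y⁻¹` of the character of `I_{r,s;n}`. -/
def coefQ (pp pm : ℕ) (r s n g : ℤ) : ℂ :=
  (-1) ^ (g * n) * (4 * Real.sin (Real.pi * g * (r / pp)) * Real.sin (Real.pi * g * (s / pm))
    / alphaFull pp pm)

/-- The coefficient of order `y⁰` of the character of `I_{r,s;n}`. -/
def coefP (pp pm : ℕ) (r s n g : ℤ) : ℂ :=
  (-1) ^ (g * n) *
    (-2 * n * Real.sin (Real.pi * g * (r / pp)) * Real.sin (Real.pi * g * (s / pm))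
      + 2 * Complex.I * (r / pp * Real.cos (Real.pi * g * (r / pp))
          * Real.sin (Real.pi * g * (s / pm))
        + s / pm * Real.cos (Real.pi * g * (s / pm)) * Real.sin (Real.pi * g * (r / pp))))

lemma phase_label (g n : ℤ) (x x' : ℝ) :
    phase g ((n : ℝ) / 2 + -1 + x / 2 + x' / 2) = (-1) ^ (g * n) *
      (Real.cos (Real.pi * g * x) + Real.sin (Real.pi * g * x) * Complex.I) *
      (Real.cos (Real.pi * g * x') + Real.sin (Real.pi * g * x') * Complex.I) := by
  rw [phase_add, phase_add, phase_add, phase_half_intCast, phase_neg_one, phase_half, phase_half,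
    mul_one]

lemma phase_label_single (g n : ℤ) (x : ℝ) :
    phase g ((n : ℝ) / 2 + -(1 / 2) + x / 2) = (-1) ^ (g * n) * (-1) ^ g *
      (Real.cos (Real.pi * g * x) + Real.sin (Real.pi * g * x) * Complex.I) := by
  have h := phase_half_intCast g (-1)
  rw [show ((-1 : ℤ) : ℝ) / 2 = -(1 / 2) by norm_num, mul_neg_one, zpow_neg, ← inv_zpow,
    inv_neg_one] at h
  rw [phase_add, phase_add, phase_half_intCast, h, phase_half]

/-- The four Fock families are weighted partial thetas with shifts n/2 - 1 ± ρ/2 ± σ/2, signed by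
the product of the two signs. Their phases therefore combine into (2i sin πgρ)(2i sin πgσ), while
the factor b + 1 of the order y⁰ coefficient, which varies with the signs, yields the mixed
sine-cosine terms. -/
lemma hasExpansion_imInnerRegChar (hpp : 0 < pp) (hpm : 0 < pm) (r s n : ℤ) {ε : ℂ}
    (hε : ε.re < 0) :
    HasExpansion (alphaFull pp pm) ε (fun y =>
      imInnerRegChar pp pm r s n ε (Complex.I * y) * ModularForm.eta (Complex.I * y))
      (coefP pp pm r s n) (coefQ pp pm r s n) := by
  have hA := alphaFull_pos hpp hpm
  set b : ℝ → ℝ → ℝ := fun x x' => (n : ℝ) / 2 + -1 + x / 2 + x' / 2 with hb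
  have hV : HasExpansion (alphaFull pp pm) ε (fun y =>
      (if 0 ≤ n then (n : ℂ) * (if Even n then virChar pp pm r s (Complex.I * y)
        else -virChar pp pm r (pm - s) (Complex.I * y)) else 0)
        * ModularForm.eta (Complex.I * y)) 0 0 := by
    split_ifs with h1 h2
    · exact ((hasExpansion_virChar hpp hpm r s ε).const_mul n).congr (fun y _ => by ring)
        (fun g => by simp) (fun g => by simp)
    · exact ((hasExpansion_virChar hpp hpm r (pm - s) ε).const_mul (-n)).congr
        (fun y _ => by ring) (fun g => by simp) (fun g => by simp)
    · exact ((hasExpansion_virChar hpp hpm r s ε).const_mul 0).congr (fun y _ => by ring)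
        (fun g => by simp) (fun g => by simp)
  have hW (x x' : ℝ) := hasExpansion_weighted_partialTheta hA hε (b x x')
  set ρ : ℝ := r / pp with hρ
  set σ : ℝ := s / pm with hσ
  refine (hV.add ((((hW ρ σ).add (hW (-ρ) (-σ))).sub (hW (-ρ) σ)).sub (hW ρ (-σ)))).congr
    (fun y hy => ?_) (fun g => ?_) (fun g => ?_)
  · have hη := eta_I_mul_ne_zero hy
    have hs (x x' : ℝ) := summable_mul_gauss_left hA ε (b x x') hy
    rw [imInnerRegChar, add_mul, ← (hs _ _).tsum_add (hs _ _),
      ← ((hs _ _).add (hs _ _)).tsum_sub (hs _ _),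
      ← (((hs _ _).add (hs _ _)).sub (hs _ _)).tsum_sub (hs _ _)]
    congr 1
    rw [← tsum_mul_right]
    refine tsum_congr fun k => ?_
    rw [fockLabelRegChar_eq hpp hpm _ _ _ ε y (b := b ρ σ - k)
        (by simp only [hb, hρ, hσ]; push_cast; field_simp; ring),
      fockLabelRegChar_eq hpp hpm _ _ _ ε y (b := b (-ρ) (-σ) - k)
        (by simp only [hb, hρ, hσ]; push_cast; field_simp; ring),
      fockLabelRegChar_eq hpp hpm _ _ _ ε y (b := b (-ρ) σ - k)
        (by simp only [hb, hρ, hσ]; push_cast; field_simp; ring),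
      fockLabelRegChar_eq hpp hpm _ _ _ ε y (b := b ρ (-σ) - k)
        (by simp only [hb, hρ, hσ]; push_cast; field_simp; ring)]
    field_simp
  · simp only [hb, phase_label, coefP, Pi.zero_apply, mul_neg, Real.cos_neg, Real.sin_neg]
    rw [← hρ, ← hσ]
    have h1 : (r / pp : ℂ) = ρ := by rw [hρ]; push_cast; rfl
    have h2 : (s / pm : ℂ) = σ := by rw [hσ]; push_cast; rfl
    rw [h1, h2]
    generalize Real.cos (Real.pi * g * ρ) = c
    generalize Real.sin (Real.pi * g * ρ) = d
    generalize Real.cos (Real.pi * g * σ) = c'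
    generalize Real.sin (Real.pi * g * σ) = d'
    push_cast
    linear_combination (-2 * n * d * d' * (-1) ^ (g * n) : ℂ) * Complex.I_sq
  · simp only [hb, phase_label, coefQ, Pi.zero_apply, mul_neg, Real.cos_neg, Real.sin_neg]
    rw [← hρ, ← hσ]
    push_cast
    linear_combination (4 * Complex.sin (Real.pi * g * ρ) * Complex.sin (Real.pi * g * σ)
      / alphaFull pp pm * (-1) ^ (g * n) : ℂ) * Complex.I_sq

end Characters

lemma neg_one_zpow_congr {K : Type*} [DivisionRing K] {a b : ℤ} (h : Even (a - b)) :
    (-1 : K) ^ a = (-1) ^ b := by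
  have h1 : (-1 : K) ≠ 0 := neg_ne_zero.2 one_ne_zero
  rw [← sub_add_cancel a b, zpow_add₀ h1, h.neg_one_zpow, one_mul]

section Characters

variable {pp pm : ℕ}

/-- Without weights only order y⁰ occurs. This agrees with the general coefficients because s = p₋
makes sin(πgs/p₋) = 0 and cos(πgs/p₋) = (-1)^g. -/
lemma hasExpansion_imPlusRegChar (hpp : 0 < pp) (hpm : 0 < pm) (r n : ℤ) {ε : ℂ}
    (hε : ε.re < 0) :
    HasExpansion (alphaFull pp pm) ε (fun y =>
      imPlusRegChar pp pm r pm n ε (Complex.I * y) * ModularForm.eta (Complex.I * y))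
      (coefP pp pm r pm n) (coefQ pp pm r pm n) := by
  have hA := alphaFull_pos hpp hpm
  set b : ℝ → ℝ := fun x => (n : ℝ) / 2 + -(1 / 2) + x / 2 with hb
  have hW (x : ℝ) := hasExpansion_partialTheta hA hε (b x)
  set ρ : ℝ := r / pp with hρ
  have hσ : (((pm : ℤ) : ℝ) / pm : ℝ) = 1 := by push_cast; field_simp
  have hcos (g : ℤ) : Real.cos (Real.pi * g) = (-1) ^ g := by
    rw [mul_comm, Real.cos_int_mul_pi]
  have hsin (g : ℤ) : Real.sin (Real.pi * g) = 0 := by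
    rw [mul_comm, Real.sin_int_mul_pi]
  refine ((hW ρ).sub (hW (-ρ))).congr (fun y hy => ?_) (fun g => ?_) (fun g => ?_)
  · have hη := eta_I_mul_ne_zero hy
    have hs (x : ℝ) := summable_gauss_left hA ε (b x) hy
    rw [imPlusRegChar, if_neg (fun h => h.1 rfl), zero_add, ← (hs _).tsum_sub (hs _),
      ← tsum_mul_right]
    refine tsum_congr fun k => ?_
    rw [fockLabelRegChar_eq hpp hpm _ _ _ ε y (b := b ρ - k)
        (by simp only [hb, hρ]; push_cast; field_simp; ring),
      fockLabelRegChar_eq hpp hpm _ _ _ ε y (b := b (-ρ) - k)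
        (by simp only [hb, hρ]; push_cast; field_simp; ring)]
    field_simp
  · simp only [hb, phase_label_single, coefP, hσ, mul_neg, Real.cos_neg, Real.sin_neg, mul_one,
      hcos, hsin]
    rw [← hρ]
    have hpm' : ((pm : ℤ) : ℂ) / pm = 1 := by exact_mod_cast congrArg Complex.ofReal hσ
    rw [hpm']
    push_cast
    ring
  · simp only [coefQ, hσ, mul_one, hsin]
    simp

lemma hasExpansion_imMinusRegChar (hpp : 0 < pp) (hpm : 0 < pm) (s n : ℤ) {ε : ℂ}
    (hε : ε.re < 0) :
    HasExpansion (alphaFull pp pm) ε (fun y =>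
      imMinusRegChar pp pm pp s n ε (Complex.I * y) * ModularForm.eta (Complex.I * y))
      (coefP pp pm pp s n) (coefQ pp pm pp s n) := by
  have hA := alphaFull_pos hpp hpm
  set b : ℝ → ℝ := fun x => (n : ℝ) / 2 + -(1 / 2) + x / 2 with hb
  have hW (x : ℝ) := hasExpansion_partialTheta hA hε (b x)
  set σ : ℝ := s / pm with hσ
  have hρ : (((pp : ℤ) : ℝ) / pp : ℝ) = 1 := by push_cast; field_simp
  have hcos (g : ℤ) : Real.cos (Real.pi * g) = (-1) ^ g := by
    rw [mul_comm, Real.cos_int_mul_pi]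
  have hsin (g : ℤ) : Real.sin (Real.pi * g) = 0 := by
    rw [mul_comm, Real.sin_int_mul_pi]
  refine ((hW σ).sub (hW (-σ))).congr (fun y hy => ?_) (fun g => ?_) (fun g => ?_)
  · have hη := eta_I_mul_ne_zero hy
    have hs (x : ℝ) := summable_gauss_left hA ε (b x) hy
    rw [imMinusRegChar, if_neg (fun h => h.1 rfl), zero_add, ← (hs _).tsum_sub (hs _),
      ← tsum_mul_right]
    refine tsum_congr fun k => ?_
    rw [fockLabelRegChar_eq hpp hpm _ _ _ ε y (b := b σ - k)
        (by simp only [hb, hσ]; push_cast; field_simp; ring),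
      fockLabelRegChar_eq hpp hpm _ _ _ ε y (b := b (-σ) - k)
        (by simp only [hb, hσ]; push_cast; field_simp; ring)]
    field_simp
  · simp only [hb, phase_label_single, coefP, hρ, mul_neg, Real.cos_neg, Real.sin_neg, mul_one,
      hcos, hsin]
    rw [← hσ]
    have hpp' : ((pp : ℤ) : ℂ) / pp = 1 := by exact_mod_cast congrArg Complex.ofReal hρ
    rw [hpp']
    push_cast
    ring
  · simp only [coefQ, hρ, mul_one, hsin]
    simp

/-- The expansion of the characters of the atypical modules, border cases included. -/
lemma hasExpansion_imRegChar (hpp : 0 < pp) (hpm : 0 < pm) (r s n : ℤ) {ε : ℂ}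
    (hε : ε.re < 0) :
    HasExpansion (alphaFull pp pm) ε (fun y =>
      imRegChar pp pm r s n ε (Complex.I * y) * ModularForm.eta (Complex.I * y))
      (coefP pp pm r s n) (coefQ pp pm r s n) := by
  unfold imRegChar
  split_ifs with h1 h2 h2
  · subst h1 h2
    have hρ : (((pp : ℤ) : ℝ) / pp : ℝ) = 1 := by push_cast; field_simp
    have hσ : (((pm : ℤ) : ℝ) / pm : ℝ) = 1 := by push_cast; field_simp
    have hsin (g : ℤ) : Real.sin (Real.pi * g) = 0 := by
      rw [mul_comm, Real.sin_int_mul_pi]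
    -- The corner module is a single Gaussian, bounded for small y, and both sines vanish there.
    refine (hasExpansion_gauss (alphaFull pp pm) ε (n / 2)).congr (fun y hy => ?_)
      (fun g => ?_) (fun g => ?_)
    · rw [fockLabelRegChar_eq hpp hpm _ _ _ ε y (b := n / 2) (by rw [hρ, hσ]; ring),
        div_mul_cancel₀ _ (eta_I_mul_ne_zero hy)]
    · simp only [coefP, hρ, hσ, mul_one, hsin]
      simp
    · simp only [coefQ, hρ, hσ, mul_one, hsin]
      simp
  · subst h1
    exact hasExpansion_imMinusRegChar hpp hpm s n hε
  · subst h2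
    exact hasExpansion_imPlusRegChar hpp hpm r n hε
  · exact hasExpansion_imInnerRegChar hpp hpm r s n hε

lemma hasExpansion_vacRegChar (hpp : 0 < pp) (hpm : 0 < pm) {ε : ℂ} (hε : ε.re < 0) :
    HasExpansion (alphaFull pp pm) ε (fun y =>
      vacRegChar pp pm ε (Complex.I * y) * ModularForm.eta (Complex.I * y))
      (coefP pp pm 1 1 0) (coefQ pp pm 1 1 0) :=
  ((hasExpansion_virChar hpp hpm 1 1 ε).add (hasExpansion_imRegChar hpp hpm 1 1 0 hε)).congr
    (fun y _ => by rw [vacRegChar, add_mul]) (fun g => by simp) (fun g => by simp)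

/-! ### From the leading index to the quantum dimension -/

/-- The dual Gaussian of index `g₀` dominates all those of index not divisible by `p₊ p₋`, and
is unbounded. -/
def IsLeading (pp pm : ℕ) (ε : ℂ) (g₀ : ℤ) : Prop :=
  (∃ δ : ℝ, 0 < δ ∧ ∀ g : ℤ, g ≠ g₀ → ((pp * pm : ℕ) : ℤ) ∣ g ∨
    δ * |((g - g₀ : ℤ) : ℝ)|
      ≤ (ε.im - g / alphaFull pp pm) ^ 2 - (ε.im - g₀ / alphaFull pp pm) ^ 2) ∧
  (ε.im - g₀ / alphaFull pp pm) ^ 2 < ε.re ^ 2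

lemma sin_eq_zero_of_dvd {a : ℕ} (ha : 0 < a) {g : ℤ} (h : (a : ℤ) ∣ g) (x : ℤ) :
    Real.sin (Real.pi * g * (x / a)) = 0 := by
  obtain ⟨l, rfl⟩ := h
  have h : Real.pi * ((a * l : ℤ) : ℝ) * (x / a) = ((l * x : ℤ) : ℝ) * Real.pi := by
    push_cast; field_simp
  rw [h, Real.sin_int_mul_pi]

lemma sin_ne_zero_of_not_dvd {a : ℕ} (ha : 0 < a) {g : ℤ} (h : ¬ (a : ℤ) ∣ g) :
    Real.sin (Real.pi * g * ((1 : ℤ) / a)) ≠ 0 := by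
  rw [Ne, Real.sin_eq_zero_iff]
  rintro ⟨l, hl⟩
  refine h ⟨l, ?_⟩
  have h1 : (g : ℝ) = a * l := by
    have hpi := Real.pi_ne_zero
    push_cast at hl
    field_simp at hl
    linarith
  exact_mod_cast h1

/-- Each summand of the coefficient contains one of the two sines. This is why `IsLeading` demands
no gap at multiples of p₊p₋. -/
lemma coefP_eq_zero (hpp : 0 < pp) (hpm : 0 < pm) (r s n : ℤ) {g : ℤ}
    (h1 : (pp : ℤ) ∣ g) (h2 : (pm : ℤ) ∣ g) : coefP pp pm r s n g = 0 := by
  rw [coefP, sin_eq_zero_of_dvd hpp h1, sin_eq_zero_of_dvd hpm h2]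
  simp

lemma coefQ_eq_zero_left (hpp : 0 < pp) (r s n : ℤ) {g : ℤ}
    (h1 : (pp : ℤ) ∣ g) : coefQ pp pm r s n g = 0 := by
  rw [coefQ, sin_eq_zero_of_dvd hpp h1]
  simp

lemma coefQ_eq_zero_right (hpm : 0 < pm) (r s n : ℤ) {g : ℤ}
    (h2 : (pm : ℤ) ∣ g) : coefQ pp pm r s n g = 0 := by
  rw [coefQ, sin_eq_zero_of_dvd hpm h2]
  simp

lemma coefQ_vac_ne_zero (hpp : 0 < pp) (hpm : 0 < pm) {g : ℤ}
    (h1 : ¬ (pp : ℤ) ∣ g) (h2 : ¬ (pm : ℤ) ∣ g) : coefQ pp pm 1 1 0 g ≠ 0 := by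
  have hA := (alphaFull_pos hpp hpm).ne'
  have h3 := sin_ne_zero_of_not_dvd hpp h1
  have h4 := sin_ne_zero_of_not_dvd hpm h2
  rw [coefQ, mul_zero, zpow_zero, one_mul]
  refine div_ne_zero (mul_ne_zero (mul_ne_zero (by norm_num) ?_) ?_) ?_
  · exact_mod_cast h3
  · exact_mod_cast h4
  · exact_mod_cast hA

lemma IsLeading.tendsto {ε : ℂ} {g₀ : ℤ} (hpp : 0 < pp) (hpm : 0 < pm)
    (h : IsLeading pp pm ε g₀) (r s n : ℤ) {X : ℝ → ℂ}
    (hX : HasExpansion (alphaFull pp pm) ε X (coefP pp pm r s n) (coefQ pp pm r s n)) :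
    Tendsto (fun y => X y / dualGauss (alphaFull pp pm) ε g₀ y - (coefP pp pm r s n g₀ +
      coefQ pp pm r s n g₀ * ((ε - Complex.I * g₀ / alphaFull pp pm) / y))) (𝓝[>] 0) (𝓝 0) := by
  obtain ⟨⟨δ, hδ, hgap⟩, hdom⟩ := h
  refine hX.tendsto_sub_lead (alphaFull_pos hpp hpm) hδ (fun g hg => ?_) hdom
  refine (hgap g hg).imp_left fun hd => ?_
  push_cast at hd
  have h1 := dvd_of_mul_right_dvd hd
  have h2 := dvd_of_mul_left_dvd hd
  exact ⟨coefP_eq_zero hpp hpm r s n h1 h2, coefQ_eq_zero_left hpp r s n h1⟩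

lemma hasQuantumDim_of_tendsto {ε a b : ℂ} {w : ℝ → ℂ} {r s n : ℤ} (hb : b ≠ 0)
    (hX : Tendsto (fun y : ℝ => imRegChar pp pm r s n ε (Complex.I * y) *
      ModularForm.eta (Complex.I * y) * w y) (𝓝[>] 0) (𝓝 a))
    (hV : Tendsto (fun y : ℝ => vacRegChar pp pm ε (Complex.I * y) *
      ModularForm.eta (Complex.I * y) * w y) (𝓝[>] 0) (𝓝 b)) :
    HasQuantumDim pp pm r s n ε (a / b) := by
  simp only [mul_assoc] at hX hV
  exact tendsto_div_of_tendsto_mul hb hX hV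

lemma IsLeading.hasQuantumDim_of_coefQ {ε : ℂ} {g₀ : ℤ} (hpp : 0 < pp) (hpm : 0 < pm)
    (hε : ε.re < 0) (h : IsLeading pp pm ε g₀) (r s n : ℤ)
    (h1 : ¬ (pp : ℤ) ∣ g₀) (h2 : ¬ (pm : ℤ) ∣ g₀) :
    HasQuantumDim pp pm r s n ε (coefQ pp pm r s n g₀ / coefQ pp pm 1 1 0 g₀) := by
  -- Its real part is Re ε < 0.
  have hz : ε - Complex.I * g₀ / alphaFull pp pm ≠ 0 := by
    intro h0
    have h3 := congrArg Complex.re h0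
    have h4 : (Complex.I * g₀ / alphaFull pp pm : ℂ)
        = ((g₀ / alphaFull pp pm : ℝ) : ℂ) * Complex.I := by push_cast; ring
    rw [h4, Complex.sub_re, Complex.mul_I_re, Complex.ofReal_im, Complex.zero_re] at h3
    linarith
  have hX := tendsto_mul_of_lead
    (h.tendsto hpp hpm r s n (hasExpansion_imRegChar hpp hpm r s n hε))
  have hV := tendsto_mul_of_lead
    (h.tendsto hpp hpm 1 1 0 (hasExpansion_vacRegChar hpp hpm hε))
  rw [← mul_div_mul_right _ _ hz]
  exact hasQuantumDim_of_tendsto (mul_ne_zero (coefQ_vac_ne_zero hpp hpm h1 h2) hz) hX hV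

lemma IsLeading.hasQuantumDim_of_coefP {ε : ℂ} {g₀ : ℤ} (hpp : 0 < pp) (hpm : 0 < pm)
    (hε : ε.re < 0) (h : IsLeading pp pm ε g₀) (r s n : ℤ)
    (hQ : ∀ r s n, coefQ pp pm r s n g₀ = 0) (hP : coefP pp pm 1 1 0 g₀ ≠ 0) :
    HasQuantumDim pp pm r s n ε (coefP pp pm r s n g₀ / coefP pp pm 1 1 0 g₀) := by
  have key {r s n : ℤ} {X : ℝ → ℂ}
      (hX : HasExpansion (alphaFull pp pm) ε X (coefP pp pm r s n) (coefQ pp pm r s n)) :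
      Tendsto (fun y => X y * (dualGauss (alphaFull pp pm) ε g₀ y)⁻¹) (𝓝[>] 0)
        (𝓝 (coefP pp pm r s n g₀)) := by
    have := (h.tendsto hpp hpm r s n hX).add_const (coefP pp pm r s n g₀)
    simpa [hQ, div_eq_mul_inv] using this
  exact hasQuantumDim_of_tendsto hP (key (hasExpansion_imRegChar hpp hpm r s n hε))
    (key (hasExpansion_vacRegChar hpp hpm hε))

end Characters

/-! ### The leading index in each strip -/

section Leading

variable {pp pm : ℕ}

lemma gap_eq {A : ℝ} (hA : 0 < A) (x : ℝ) (g g₀ : ℤ) :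
    (x - g / A) ^ 2 - (x - g₀ / A) ^ 2
      = (((g - g₀ : ℤ) : ℝ) ^ 2 - 2 * ((g - g₀ : ℤ) : ℝ) * (A * x - g₀)) / A ^ 2 := by
  push_cast
  field_simp
  ring

/-- The gap makes g₀ a minimiser of |g/A - Im ε| over the indices in the definition of `wall`, so
the wall condition gives Re ε < -|Im ε - g₀/A|, which is growth. -/
lemma isLeading_of_gap (hpp : 0 < pp) (hpm : 0 < pm) {ε : ℂ}
    (hwall : ε.re < wall (pp * pm) ε) {g₀ : ℤ} (hg₀ : ¬ ((pp * pm : ℕ) : ℤ) ∣ g₀) {δ : ℝ}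
    (hδ : 0 < δ) (h : ∀ g : ℤ, g ≠ g₀ → ((pp * pm : ℕ) : ℤ) ∣ g ∨
      δ * |((g - g₀ : ℤ) : ℝ)| ≤ ((g - g₀ : ℤ) : ℝ) ^ 2
        - 2 * ((g - g₀ : ℤ) : ℝ) * (alphaFull pp pm * ε.im - g₀)) :
    IsLeading pp pm ε g₀ := by
  have hA := alphaFull_pos hpp hpm
  have hgap : ∀ g : ℤ, g ≠ g₀ → ((pp * pm : ℕ) : ℤ) ∣ g ∨
      δ / alphaFull pp pm ^ 2 * |((g - g₀ : ℤ) : ℝ)|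
        ≤ (ε.im - g / alphaFull pp pm) ^ 2 - (ε.im - g₀ / alphaFull pp pm) ^ 2 := by
    intro g hg
    refine (h g hg).imp_right fun h1 => ?_
    rw [gap_eq hA, div_mul_eq_mul_div]
    gcongr
  refine ⟨⟨_, by positivity, hgap⟩, ?_⟩
  have hsqrt : Real.sqrt (2 * ((pp * pm : ℕ) : ℝ)) = alphaFull pp pm := by
    rw [alphaFull]; push_cast; rw [mul_assoc]
  have hmin : |ε.im - g₀ / alphaFull pp pm| ≤
      sInf {d : ℝ | ∃ m : ℤ, ¬ ((pp * pm : ℕ) : ℤ) ∣ m ∧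
        d = |m / Real.sqrt (2 * ((pp * pm : ℕ) : ℝ)) - ε.im|} := by
    refine le_csInf ⟨_, g₀, hg₀, rfl⟩ ?_
    rintro d ⟨g, hg, rfl⟩
    rw [hsqrt, abs_sub_comm (_ / _) ε.im]
    by_cases hgg : g = g₀
    · rw [hgg]
    rw [← sq_le_sq, ← sub_nonneg]
    refine le_trans ?_ ((hgap g hgg).resolve_left hg)
    positivity
  have h1 : ε.re < -|ε.im - g₀ / alphaFull pp pm| := by
    rw [wall] at hwall
    linarith
  rw [← sq_abs (ε.im - _), ← neg_sq ε.re]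
  exact pow_lt_pow_left₀ (by linarith) (abs_nonneg _) two_ne_zero

/-- No condition on q is needed, as `sInf ∅ = 0`. -/
lemma re_neg_of_lt_wall {q : ℕ} {ε : ℂ} (h : ε.re < wall q ε) : ε.re < 0 := by
  refine h.trans_le (neg_nonpos.2 (Real.sInf_nonneg ?_))
  rintro d ⟨m, -, rfl⟩
  exact abs_nonneg _

lemma abs_sub_lt_of_mem_strip (hpp : 0 < pp) (hpm : 0 < pm) {ε : ℂ} {k m : ℤ}
    (h : ε ∈ strip pp pm k m) :
    |alphaFull pp pm * ε.im - ((2 * pp * pm * k + m : ℤ) : ℝ)| < 1 / 2 := by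
  have hA := alphaFull_pos hpp hpm
  have hx : ε.im / Real.sqrt (2 * pp * pm) = alphaFull pp pm * ε.im / (2 * pp * pm) := by
    change ε.im / alphaFull pp pm = _
    rw [← alphaFull_sq]
    field_simp
  obtain ⟨h1, h2⟩ := h
  rw [hx] at h1 h2
  have hN : (0 : ℝ) < 2 * pp * pm := by positivity
  rw [lt_div_iff₀ hN] at h1
  rw [div_lt_iff₀ hN] at h2
  have e1 : ((k : ℝ) + (2 * m - 1) / (4 * pp * pm)) * (2 * pp * pm)
      = 2 * pp * pm * k + m - 1 / 2 := by field_simp; ring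
  have e2 : ((k : ℝ) + (2 * m + 1) / (4 * pp * pm)) * (2 * pp * pm)
      = 2 * pp * pm * k + m + 1 / 2 := by field_simp; ring
  rw [e1] at h1
  rw [e2] at h2
  push_cast
  rw [abs_lt]
  constructor <;> linarith

/-- In a strip whose centre line is not singular, the nearest index leads. -/
lemma isLeading_of_mem_strip (hpp : 0 < pp) (hpm : 0 < pm) {ε : ℂ}
    (hwall : ε.re < wall (pp * pm) ε) {k m : ℤ} (h : ε ∈ strip pp pm k m)
    (hm : ¬ ((pp * pm : ℕ) : ℤ) ∣ m) : IsLeading pp pm ε (2 * pp * pm * k + m) := by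
  have ht := abs_sub_lt_of_mem_strip hpp hpm h
  set t := alphaFull pp pm * ε.im - ((2 * pp * pm * k + m : ℤ) : ℝ) with htdef
  -- With d = g - g₀ one has d² - 2dt ≥ |d|(|d| - 2|t|) and |d| ≥ 1, and the strip gives |t| < 1/2.
  refine isLeading_of_gap hpp hpm hwall ?_ (δ := 1 - 2 * |t|) (by linarith) fun g hg => Or.inr ?_
  · intro h1
    refine hm ((dvd_add_right ⟨2 * k, ?_⟩).1 h1)
    push_cast; ring
  · rw [← htdef]
    have hd : (1 : ℝ) ≤ |((g - (2 * pp * pm * k + m) : ℤ) : ℝ)| := by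
      rw [← Int.cast_abs]
      exact_mod_cast Int.one_le_abs (sub_ne_zero.2 hg)
    generalize ((g - (2 * pp * pm * k + m) : ℤ) : ℝ) = d at hd ⊢
    have h2 : d * t ≤ |d| * |t| := (le_abs_self _).trans (abs_mul d t).le
    rw [← sq_abs d]
    nlinarith

/-- In a strip with singular centre line, one of the neighbours of the nearest index leads. -/
lemma isLeading_of_mem_strip_of_dvd (hpp : 2 ≤ pp) (hpm : 2 ≤ pm) {ε : ℂ}
    (hwall : ε.re < wall (pp * pm) ε) {k m : ℤ} (h : ε ∈ strip pp pm k m)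
    (hm : ((pp * pm : ℕ) : ℤ) ∣ m)
    (hoff : ε.im / Real.sqrt (2 * pp * pm) ≠ k + m / (2 * pp * pm)) :
    ∃ σ : ℤ, (σ = 1 ∨ σ = -1) ∧ IsLeading pp pm ε (2 * pp * pm * k + m + σ) := by
  have hpp0 : 0 < pp := by omega
  have hpm0 : 0 < pm := by omega
  have ht := abs_sub_lt_of_mem_strip hpp0 hpm0 h
  have hdvd : ((pp * pm : ℕ) : ℤ) ∣ 2 * pp * pm * k + m :=
    dvd_add ⟨2 * k, by push_cast; ring⟩ hm
  have hne : alphaFull pp pm * ε.im - ((2 * pp * pm * k + m : ℤ) : ℝ) ≠ 0 := by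
    intro h0
    apply hoff
    have hA := alphaFull_pos hpp0 hpm0
    change ε.im / alphaFull pp pm = _
    have hN : (0 : ℝ) < 2 * pp * pm := by positivity
    have h1 : ε.im / alphaFull pp pm = alphaFull pp pm * ε.im / (2 * pp * pm) := by
      rw [← alphaFull_sq]; field_simp
    rw [h1, sub_eq_zero.1 h0]
    push_cast
    field_simp
  generalize (2 * pp * pm * k + m : ℤ) = c at *
  set t := alphaFull pp pm * ε.im - (c : ℝ) with htdef
  have hN : (2 : ℤ) ≤ ((pp * pm : ℕ) : ℤ) := by
    push_cast; exact_mod_cast (by nlinarith : 2 ≤ pp * pm)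
  rw [abs_lt] at ht
  rcases lt_or_gt_of_ne hne with hneg | hpos
  -- Below the centre line c - 1 leads. Relative to it the offset is t + 1, and since c itself is
  -- silent the competitors have d ≤ -1 or d ≥ 2; the tight one is d = 2, that is c + 1, where d -
  -- 2(t + 1) = -2t.
  · refine ⟨-1, Or.inr rfl, isLeading_of_gap hpp0 hpm0 hwall ?_ (δ := -2 * t) (by linarith)
      fun g hg => ?_⟩
    · intro h1
      have h2 := Int.le_of_dvd one_pos ((dvd_neg.1 ((dvd_add_right hdvd).1 h1)))
      omega
    · by_cases hgc : g = c
      · exact Or.inl (hgc ▸ hdvd)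
      right
      have h3 : alphaFull pp pm * ε.im - ((c + -1 : ℤ) : ℝ) = t + 1 := by
        rw [htdef]; push_cast; ring
      rw [h3]
      rcases lt_or_gt_of_ne hg with hlt | hgt
      · have hd : ((g - (c + -1) : ℤ) : ℝ) ≤ -1 := by exact_mod_cast (by omega)
        generalize ((g - (c + -1) : ℤ) : ℝ) = d at hd ⊢
        rw [abs_of_neg (by linarith)]
        nlinarith
      · have hd : (2 : ℝ) ≤ ((g - (c + -1) : ℤ) : ℝ) := by exact_mod_cast (by omega)
        generalize ((g - (c + -1) : ℤ) : ℝ) = d at hd ⊢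
        rw [abs_of_pos (by linarith)]
        nlinarith
  · refine ⟨1, Or.inl rfl, isLeading_of_gap hpp0 hpm0 hwall ?_ (δ := 2 * t) (by linarith)
      fun g hg => ?_⟩
    · intro h1
      have h2 := Int.le_of_dvd one_pos ((dvd_add_right hdvd).1 h1)
      omega
    · by_cases hgc : g = c
      · exact Or.inl (hgc ▸ hdvd)
      right
      have h3 : alphaFull pp pm * ε.im - ((c + 1 : ℤ) : ℝ) = t - 1 := by
        rw [htdef]; push_cast; ring
      rw [h3]
      rcases lt_or_gt_of_ne hg with hlt | hgt
      · have hd : ((g - (c + 1) : ℤ) : ℝ) ≤ -2 := by exact_mod_cast (by omega)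
        generalize ((g - (c + 1) : ℤ) : ℝ) = d at hd ⊢
        rw [abs_of_neg (by linarith)]
        nlinarith
      · have hd : (1 : ℝ) ≤ ((g - (c + 1) : ℤ) : ℝ) := by exact_mod_cast (by omega)
        generalize ((g - (c + 1) : ℤ) : ℝ) = d at hd ⊢
        rw [abs_of_pos (by linarith)]
        nlinarith

end Leading

/-! ### Ratios of leading coefficients -/

section Values

variable {pp pm : ℕ}

lemma coefQ_div_coefQ (hpp : 0 < pp) (hpm : 0 < pm) (r s n g : ℤ) :
    coefQ pp pm r s n g / coefQ pp pm 1 1 0 g =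
      (((-1 : ℝ) ^ (g * n) *
        ((Real.sin (Real.pi * g * (r / pp)) * Real.sin (Real.pi * g * (s / pm))) /
          (Real.sin (Real.pi * g * ((1 : ℤ) / pp)) * Real.sin (Real.pi * g * ((1 : ℤ) / pm))))
          : ℝ) : ℂ) := by
  have hA : (alphaFull pp pm : ℂ) ≠ 0 := by exact_mod_cast (alphaFull_pos hpp hpm).ne'
  rw [coefQ, coefQ, mul_zero, zpow_zero, one_mul, mul_div_assoc, div_div_div_cancel_right₀ hA,
    mul_assoc (4 : ℂ), mul_assoc (4 : ℂ), mul_div_mul_left _ _ (by norm_num : (4 : ℂ) ≠ 0)]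
  push_cast
  rfl

lemma sin_shift (a : ℕ) (ha : 0 < a) (j g r : ℤ) :
    Real.sin (Real.pi * ((a * j + g : ℤ) : ℝ) * (r / a))
      = (-1) ^ (j * r) * Real.sin (Real.pi * g / a * r) := by
  rw [← Real.sin_add_int_mul_pi]
  congr 1
  push_cast
  field_simp
  ring

/-- The shift by 2p₊p₋k moves both sine arguments by multiples of 2π and keeps the parity of the
index, so k drops out. -/
lemma coefQ_ratio_generic (hpp : 0 < pp) (hpm : 0 < pm) (k m r s n : ℤ) :
    coefQ pp pm r s n (2 * pp * pm * k + m) / coefQ pp pm 1 1 0 (2 * pp * pm * k + m) =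
      (((-1 : ℝ) ^ (m * n) *
        ((Real.sin (Real.pi * m / pp * r) * Real.sin (Real.pi * m / pm * s)) /
          (Real.sin (Real.pi * m / pp) * Real.sin (Real.pi * m / pm))) : ℝ) : ℂ) := by
  have e1 : (2 * pp * pm * k + m : ℤ) = pp * (2 * pm * k) + m := by ring
  have e2 : (2 * pp * pm * k + m : ℤ) = pm * (2 * pp * k) + m := by ring
  have h1 (r : ℤ) : Real.sin (Real.pi * ((2 * pp * pm * k + m : ℤ) : ℝ) * (r / pp))
      = Real.sin (Real.pi * m / pp * r) := by
    rw [e1, sin_shift pp hpp, Even.neg_one_zpow ⟨pm * k * r, by ring⟩, one_mul]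
  have h2 (s : ℤ) : Real.sin (Real.pi * ((2 * pp * pm * k + m : ℤ) : ℝ) * (s / pm))
      = Real.sin (Real.pi * m / pm * s) := by
    rw [e2, sin_shift pm hpm, Even.neg_one_zpow ⟨pp * k * s, by ring⟩, one_mul]
  rw [coefQ_div_coefQ hpp hpm, h1, h1, h2, h2, Int.cast_one, mul_one, mul_one,
    neg_one_zpow_congr (b := m * n) ⟨pp * pm * k * n, by ring⟩]

/-- The choice of neighbour does not matter: σ is odd, so the parity of the index is fixed, and each
product of two sines carries the factor σ², which cancels. Here e = 0 and e = 1 serve m = 0 and m =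
p₊p₋. -/
lemma coefQ_ratio_center (hpp : 0 < pp) (hpm : 0 < pm) (k e r s n : ℤ) {σ : ℤ}
    (hσ : σ = 1 ∨ σ = -1) :
    coefQ pp pm r s n (2 * pp * pm * k + e * (pp * pm) + σ)
        / coefQ pp pm 1 1 0 (2 * pp * pm * k + e * (pp * pm) + σ) =
      (((-1 : ℝ) ^ ((e * (pp * pm) + 1) * n + e * (pm * (r - 1) + pp * (s - 1))) *
        ((Real.sin (Real.pi * r / pp) * Real.sin (Real.pi * s / pm)) /
          (Real.sin (Real.pi / pp) * Real.sin (Real.pi / pm))) : ℝ) : ℂ) := by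
  have e1 : (2 * pp * pm * k + e * (pp * pm) + σ : ℤ) = pp * (pm * (2 * k + e)) + σ := by ring
  have e2 : (2 * pp * pm * k + e * (pp * pm) + σ : ℤ) = pm * (pp * (2 * k + e)) + σ := by ring
  have hs (a : ℕ) (x : ℤ) : Real.sin (Real.pi * σ / a * x) = σ * Real.sin (Real.pi * x / a) := by
    rcases hσ with rfl | rfl
    · rw [Int.cast_one, one_mul, mul_one]; congr 1; ring
    · rw [Int.cast_neg, Int.cast_one, neg_one_mul, ← Real.sin_neg]; congr 1; ring
  have h1 (r : ℤ) : Real.sin (Real.pi * ((2 * pp * pm * k + e * (pp * pm) + σ : ℤ) : ℝ) * (r / pp))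
      = (-1) ^ (e * pm * r) * (σ * Real.sin (Real.pi * r / pp)) := by
    rw [e1, sin_shift pp hpp, hs, neg_one_zpow_congr (b := e * pm * r) ⟨pm * k * r, by ring⟩]
  have h2 (s : ℤ) : Real.sin (Real.pi * ((2 * pp * pm * k + e * (pp * pm) + σ : ℤ) : ℝ) * (s / pm))
      = (-1) ^ (e * pp * s) * (σ * Real.sin (Real.pi * s / pm)) := by
    rw [e2, sin_shift pm hpm, hs, neg_one_zpow_congr (b := e * pp * s) ⟨pp * k * s, by ring⟩]
  have hn : (-1 : ℝ) ≠ 0 := by norm_num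
  have hpar : (-1 : ℝ) ^ ((2 * pp * pm * k + e * (pp * pm) + σ) * n)
      = (-1) ^ ((e * (pp * pm) + 1) * n) := by
    rcases hσ with rfl | rfl
    · exact neg_one_zpow_congr ⟨pp * pm * k * n, by ring⟩
    · exact neg_one_zpow_congr ⟨pp * pm * k * n - n, by ring⟩
  have hσ0 : (σ : ℝ) ≠ 0 := by rcases hσ with rfl | rfl <;> norm_num
  have hsplit : (-1 : ℝ) ^ ((e * (pp * pm) + 1) * n + e * (pm * (r - 1) + pp * (s - 1)))
      = (-1) ^ ((e * (pp * pm) + 1) * n) * ((-1) ^ (e * pm * r) * (-1) ^ (e * pp * s)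
        / ((-1) ^ (e * pm * 1) * (-1) ^ (e * pp * 1))) := by
    rw [← zpow_add₀ hn, ← zpow_add₀ hn, ← zpow_sub₀ hn, ← zpow_add₀ hn]
    congr 1; ring
  rw [coefQ_div_coefQ hpp hpm, h1, h1, h2, h2, hpar, hsplit, Int.cast_one, mul_one Real.pi]
  congr 1
  have h3 (j : ℤ) : (-1 : ℝ) ^ j ≠ 0 := zpow_ne_zero _ hn
  have h4 := h3 (e * pm * 1)
  have h5 := h3 (e * pp * 1)
  rw [mul_assoc ((-1 : ℝ) ^ ((e * (pp * pm) + 1) * n))]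
  congr 1
  rw [div_mul_div_comm]
  rw [← mul_div_mul_right (_ * (Real.sin (Real.pi * r / pp) * Real.sin (Real.pi * s / pm)))
    _ (mul_ne_zero hσ0 hσ0)]
  congr 1 <;> ring

lemma coefP_swap (pp pm : ℕ) (r s n g : ℤ) : coefP pp pm r s n g = coefP pm pp s r n g := by
  rw [coefP, coefP]; ring

/-- When p₋ divides g, sin(πgs/p₋) vanishes and cos(πgs/p₋) is a sign. The single surviving term
carries the prefactor s of the quantum dimension. -/
lemma coefP_of_dvd (hpm : 0 < pm) (r s n u : ℤ) :
    coefP pp pm r s n (pm * u) = 2 * Complex.I / pm * (((-1) ^ (pm * u * n) * (s * (-1) ^ (u * s) *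
      Real.sin (Real.pi * ((pm * u : ℤ) : ℝ) * (r / pp))) : ℝ) : ℂ) := by
  have hc : Real.cos (Real.pi * ((pm * u : ℤ) : ℝ) * (s / pm)) = (-1) ^ (u * s) := by
    rw [← Real.cos_int_mul_pi]
    congr 1
    push_cast
    field_simp
  rw [coefP, sin_eq_zero_of_dvd hpm ⟨u, rfl⟩, hc]
  push_cast
  ring

lemma coefP_ratio (hpp : 0 < pp) (hpm : 0 < pm) (k t r s n : ℤ) :
    coefP pp pm r s n (2 * pp * pm * k + t * pm) / coefP pp pm 1 1 0 (2 * pp * pm * k + t * pm) =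
      ((s * (-1 : ℝ) ^ (t * (pm * n + 1 + s)) *
        (Real.sin (Real.pi * (t * pm) / pp * r) / Real.sin (Real.pi * (t * pm) / pp)) : ℝ)
        : ℂ) := by
  have hg : (2 * pp * pm * k + t * pm : ℤ) = pm * (2 * pp * k + t) := by ring
  have hs (r : ℤ) : Real.sin (Real.pi * ((pm * (2 * pp * k + t) : ℤ) : ℝ) * (r / pp))
      = Real.sin (Real.pi * (t * pm) / pp * r) := by
    have e1 : (pm * (2 * pp * k + t) : ℤ) = pp * (2 * pm * k) + t * pm := by ring
    rw [e1, sin_shift pp hpp, Even.neg_one_zpow ⟨pm * k * r, by ring⟩, one_mul]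
    push_cast; rfl
  have hI : 2 * Complex.I / pm ≠ 0 :=
    div_ne_zero (mul_ne_zero two_ne_zero Complex.I_ne_zero) (by exact_mod_cast hpm.ne')
  have hn : (-1 : ℝ) ≠ 0 := by norm_num
  rw [hg, coefP_of_dvd hpm, coefP_of_dvd hpm, mul_div_mul_left _ _ hI, ← Complex.ofReal_div, hs, hs,
    mul_zero, zpow_zero, one_mul, Int.cast_one, one_mul, mul_one, mul_one]
  congr 1
  have hpar : (-1 : ℝ) ^ (t * (pm * n + 1 + s)) =
      (-1) ^ (pm * (2 * pp * k + t) * n) * (-1) ^ ((2 * pp * k + t) * s)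
        / (-1) ^ (2 * pp * k + t) := by
    rw [← zpow_add₀ hn, ← zpow_sub₀ hn]
    exact neg_one_zpow_congr ⟨t - pm * pp * k * n - pp * k * s + pp * k, by ring⟩
  rw [hpar]
  ring

/-- The surviving sine vanishes only at multiples of p₊. -/
lemma coefP_vac_ne_zero (hpp : 0 < pp) (hpm : 0 < pm) {g : ℤ} (h1 : ¬ (pp : ℤ) ∣ g)
    (h2 : (pm : ℤ) ∣ g) : coefP pp pm 1 1 0 g ≠ 0 := by
  obtain ⟨u, rfl⟩ := h2
  rw [coefP_of_dvd hpm]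
  refine mul_ne_zero (div_ne_zero (mul_ne_zero two_ne_zero Complex.I_ne_zero)
    (by exact_mod_cast hpm.ne')) (Complex.ofReal_ne_zero.2 ?_)
  have hn : (-1 : ℝ) ≠ 0 := by norm_num
  exact mul_ne_zero (zpow_ne_zero _ hn) (mul_ne_zero (mul_ne_zero (by simp) (zpow_ne_zero _ hn))
    (sin_ne_zero_of_not_dvd hpp h1))

lemma not_dvd_add_unit {a : ℕ} (ha : 2 ≤ a) {c σ : ℤ} (hc : (a : ℤ) ∣ c)
    (hσ : σ = 1 ∨ σ = -1) : ¬ (a : ℤ) ∣ c + σ := by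
  intro h
  have h1 : (a : ℤ) ∣ 1 := by
    rcases hσ with rfl | rfl
    · exact (dvd_add_right hc).1 h
    · exact dvd_neg.1 ((dvd_add_right hc).1 h)
  have := Int.le_of_dvd one_pos h1
  omega

lemma hasQuantumDim_center (hpp : 2 ≤ pp) (hpm : 2 ≤ pm) {k e : ℤ} {ε : ℂ}
    (hwall : ε.re < wall (pp * pm) ε) (hstrip : ε ∈ strip pp pm k (e * (pp * pm)))
    (hoff : ε.im / Real.sqrt (2 * pp * pm) ≠ k + (e * (pp * pm) : ℤ) / (2 * pp * pm))
    (r s n : ℤ) :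
    HasQuantumDim pp pm r s n ε
      (((-1 : ℝ) ^ ((e * (pp * pm) + 1) * n + e * (pm * (r - 1) + pp * (s - 1))) *
        ((Real.sin (Real.pi * r / pp) * Real.sin (Real.pi * s / pm)) /
          (Real.sin (Real.pi / pp) * Real.sin (Real.pi / pm))) : ℝ) : ℂ) := by
  have hpp0 : 0 < pp := by omega
  have hpm0 : 0 < pm := by omega
  obtain ⟨σ, hσ, hlead⟩ := isLeading_of_mem_strip_of_dvd hpp hpm hwall hstrip
    ⟨e, by push_cast; ring⟩ hoff
  rw [← coefQ_ratio_center hpp0 hpm0 k e r s n hσ]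
  refine hlead.hasQuantumDim_of_coefQ hpp0 hpm0 (re_neg_of_lt_wall hwall) r s n
    (not_dvd_add_unit hpp ⟨2 * pm * k + e * pm, by ring⟩ hσ)
    (not_dvd_add_unit hpm ⟨2 * pp * k + e * pp, by ring⟩ hσ)

end Values

end Singlet

end

/-! ### The five cases -/

theorem mainTheorem4 (pp pm : ℕ) (hpp : 2 ≤ pp) (hpm : 2 ≤ pm) (hcop : Nat.Coprime pp pm)
    (k m : ℤ) (hm0 : 0 ≤ m) (hm1 : m ≤ 2 * pp * pm - 1)
    (ε : ℂ) (hwall : ε.re < Singlet.wall (pp * pm) ε) (hstrip : ε ∈ Singlet.strip pp pm k m)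
    (r s n : ℤ) (hr1 : 1 ≤ r) (hrp : r ≤ pp) (hs1 : 1 ≤ s) (hsp : s ≤ pm) :
    (¬ (pp : ℤ) ∣ m → ¬ (pm : ℤ) ∣ m →
      Singlet.HasQuantumDim pp pm r s n ε
        (((-1 : ℝ) ^ (m * n) *
          ((Real.sin (Real.pi * m / pp * r) * Real.sin (Real.pi * m / pm * s)) /
            (Real.sin (Real.pi * m / pp) * Real.sin (Real.pi * m / pm))) : ℝ) : ℂ)) ∧
    (∀ t : ℤ, m = t * pm → ¬ (pp : ℤ) ∣ m →
      Singlet.HasQuantumDim pp pm r s n ε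
        ((s * (-1 : ℝ) ^ (t * (pm * n + 1 + s)) *
          (Real.sin (Real.pi * (t * pm) / pp * r) / Real.sin (Real.pi * (t * pm) / pp)) : ℝ)
          : ℂ)) ∧
    (∀ t : ℤ, m = t * pp → ¬ (pm : ℤ) ∣ m →
      Singlet.HasQuantumDim pp pm r s n ε
        ((r * (-1 : ℝ) ^ (t * (pp * n + 1 + r)) *
          (Real.sin (Real.pi * (t * pp) / pm * s) / Real.sin (Real.pi * (t * pp) / pm)) : ℝ)
          : ℂ)) ∧
    (m = 0 → ε.im / Real.sqrt (2 * pp * pm) ≠ k + m / (2 * pp * pm) →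
      Singlet.HasQuantumDim pp pm r s n ε
        (((-1 : ℝ) ^ n *
          ((Real.sin (Real.pi * r / pp) * Real.sin (Real.pi * s / pm)) /
            (Real.sin (Real.pi / pp) * Real.sin (Real.pi / pm))) : ℝ) : ℂ)) ∧
    (m = pp * pm → ε.im / Real.sqrt (2 * pp * pm) ≠ k + m / (2 * pp * pm) →
      Singlet.HasQuantumDim pp pm r s n ε
        (((-1 : ℝ) ^ ((m + 1) * n + pm * (r - 1) + pp * (s - 1)) *
          ((Real.sin (Real.pi * r / pp) * Real.sin (Real.pi * s / pm)) /
            (Real.sin (Real.pi / pp) * Real.sin (Real.pi / pm))) : ℝ) : ℂ)) := by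
  have hpp0 : 0 < pp := by omega
  have hpm0 : 0 < pm := by omega
  have hε := Singlet.re_neg_of_lt_wall hwall
  have hdp {g : ℤ} : (pp : ℤ) ∣ 2 * pp * pm * k + g ↔ (pp : ℤ) ∣ g :=
    dvd_add_right ⟨2 * pm * k, by ring⟩
  have hdm {g : ℤ} : (pm : ℤ) ∣ 2 * pp * pm * k + g ↔ (pm : ℤ) ∣ g :=
    dvd_add_right ⟨2 * pp * k, by ring⟩
  have hN {g : ℤ} (h : ((pp * pm : ℕ) : ℤ) ∣ g) : (pp : ℤ) ∣ g ∧ (pm : ℤ) ∣ g := by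
    push_cast at h
    exact ⟨dvd_of_mul_right_dvd h, dvd_of_mul_left_dvd h⟩
  refine ⟨fun h1 h2 => ?_, fun t ht h1 => ?_, fun t ht h2 => ?_, fun h0 hoff => ?_,
    fun h0 hoff => ?_⟩
  · rw [← Singlet.coefQ_ratio_generic hpp0 hpm0 k]
    exact (Singlet.isLeading_of_mem_strip hpp0 hpm0 hwall hstrip fun h => h1
      (hN h).1).hasQuantumDim_of_coefQ hpp0 hpm0 hε r s n
      (mt hdp.1 h1) (mt hdm.1 h2)
  · subst ht
    rw [← Singlet.coefP_ratio hpp0 hpm0 k]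
    have h2 := hdm.2 (dvd_mul_left (pm : ℤ) t)
    exact (Singlet.isLeading_of_mem_strip hpp0 hpm0 hwall hstrip fun h => h1
      (hN h).1).hasQuantumDim_of_coefP hpp0 hpm0 hε r s n
      (fun _ _ _ => Singlet.coefQ_eq_zero_right hpm0 _ _ _ h2)
      (Singlet.coefP_vac_ne_zero hpp0 hpm0 (mt hdp.1 h1) h2)
  · subst ht
    have h1 := hdp.2 (dvd_mul_left (pp : ℤ) t)
    have e1 : (2 * pm * pp * k + t * pp : ℤ) = 2 * pp * pm * k + t * pp := by ring
    -- This case is the previous one with (p₊, r) and (p₋, s) exchanged, under which `coefP` is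
    -- symmetric.
    rw [← Singlet.coefP_ratio hpm0 hpp0 k t s r n, Singlet.coefP_swap pm, Singlet.coefP_swap pm, e1]
    refine (Singlet.isLeading_of_mem_strip hpp0 hpm0 hwall hstrip fun h => h2
      (hN h).2).hasQuantumDim_of_coefP hpp0 hpm0 hε r s n
      (fun _ _ _ => Singlet.coefQ_eq_zero_left hpp0 _ _ _ h1) ?_
    rw [Singlet.coefP_swap]
    exact Singlet.coefP_vac_ne_zero hpm0 hpp0 (mt hdm.1 h2) h1
  · have h1 : m = 0 * (pp * pm) := by rw [h0, zero_mul]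
    subst h1
    simpa using Singlet.hasQuantumDim_center hpp hpm hwall hstrip hoff r s n
  · have h1 : m = 1 * (pp * pm) := by rw [h0, one_mul]
    subst h1
    have h2 := Singlet.hasQuantumDim_center hpp hpm hwall hstrip hoff r s n
    rwa [one_mul (_ + _ : ℤ), ← add_assoc] at h2
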